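/- **Setting (protocol BB84-INFO-$z$).** Fix integers $n,n_z,n_x>0$, $r\ge 0$ and $m\ge 1$, put $N=n+n_z+n_x$, and fix thresholds $p_{a,z},p_{a,x}>0$. Let $P_C$ be an $r\times n$ and $P_K$ an $m\times n$ matrix over $\mathbf F_2$, with rows $v_1,\dots,v_r$ and $v_{r+1},\dots,v_{r+m}$ respectively. Write $|\cdot|$ for Hamming weight and $d_H$ for Hamming distance, $V_{r'}=\operatorname{Span}\{v_1,\dots,v_{r'}\}$, and $$d_{r,m}=\min_{r\le r'<r+m} d_H(v_{r'+1},V_{r'}).$$ Let $|0^0\rangle,|1^0\rangle$ be the computational ($z$) basis of a qubit and $|0^1\rangle,|1^1\rangle=\frac{|0^0\rangle\pm|1^0\rangle}{\sqrt2}$ the $x$ basis. Alice chooses, uniformly and independently, a string $\mathbf i\in\mathbf F_2^N$ and a partition $\mathcal P=(\mathbf s,\mathbf z,\mathbf b)$ of the $N$ positions, that is, $\mathbf s,\mathbf z,\mathbf b\in\mathbf F_2^N$ with $|\mathbf s|=n$, $|\mathbf z|=n_z$, $|\mathbf b|=n_x$, $|\mathbf s+\mathbf z+\mathbf b|=N$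 (INFO, TEST-Z and TEST-X positions), and sends the qubits $|i_j^{b_j}\rangle$. Eve performs a collective attack, chosen independently of $\mathbf i$ and $\mathcal P$: to the $j$-th qubit she attaches a finite-dimensional probe in a pure state, applies a unitary $U_j$ to probe and qubit, keeps the probe, and forwards the qubit. Bob measures the $j$-th qubit in the basis $b_j$, obtaining $\mathbf i^B\in\mathbf F_2^N$. Let $P(\mathbf i,\mathbf i^B,\mathcal P)$ be the joint probability, and let $\rho^{E}_{\mathbf i,\mathbf i^B,\mathcal P}$ be the resulting normalized state of Eve's probes given $\mathbf i,\mathbf i^B,\mathcal P$. Put $\mathbf c=\mathbf i+\mathbf i^B$, write $\mathbf a_{\mathbf s},\mathbf a_{\mathbf z},\mathbf a_{\mathbf b}$ for the substrings of $\mathbf a$ at the INFO, TEST-Z and TEST-X positions, and let $\mathbf T=1$ if $|\mathbf c_{\mathbf z}|/n_z\le p_{a,z}$ and $|\mathbf c_{\mathbf b}|/n_x\le p_{a,x}$, and $\mathbf T=0$ otherwise (the protocol aborts). Put $\mathbf x=\mathbf i_{\mathbf s}$, $\mathbf x^B=\mathbf i^B_{\mathbf s}$, $\boldsymbol\xi=\mathbf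 xP_C^{T}$ (the published syndrome) and $\mathbf k=\mathbf xP_K^{T}$ (Alice's final key); let $\mathbf k'=\mathbf{y}P_K^{T}$ be Bob's final key, where $\mathbf y$ is obtained from $\mathbf x^B$ and $\boldsymbol\xi$ by any fixed error correction map. Let $\mathbf t=(\mathbf i_{\mathbf z},\mathbf i_{\mathbf b},\mathbf i^B_{\mathbf z},\mathbf i^B_{\mathbf b})$ be the published test bits. Define $$\rho_{ABE}=\sum_{\mathbf i,\mathbf i^B,\mathcal P\,\mid\,\mathbf T=1}P(\mathbf i,\mathbf i^B,\mathcal P)\;|\mathbf k\rangle\langle\mathbf k|_A\otimes|\mathbf k'\rangle\langle\mathbf k'|_B\otimes\rho^{E}_{\mathbf i,\mathbf i^B,\mathcal P}\otimes|\mathbf t,\mathcal P,\boldsymbol\xi\rangle\langle\mathbf t,\mathcal P,\boldsymbol\xi|_C ,$$ let $\rho'_{ABE}$ be the same sum with $|\mathbf k\rangle\langle\mathbf k|_B$ in place of $|\mathbf k'\rangle\langle\mathbf k'|_B$, and let $$\rho_U=\frac1{2^m}\sum_{\mathbf k\in\mathbf F_2^m}|\mathbf k\rangle\langle\mathbf k|_A\otimes|\mathbf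 k\rangle\langle\mathbf k|_B,\qquad \rho_E=\operatorname{tr}_{AB}(\rho_{ABE}),$$ where Eve's system consists of her probes and of the classical register $C$. **Proposition.** Let $\delta,R,\epsilon_{\mathrm{sec}}>0$. Suppose that $v_1,\dots,v_{r+m}$ are linearly independent, that $\delta<\frac{d_{r,m}}{n}$ and $\frac mn\le R$, and that $p_{a,x}+\epsilon_{\mathrm{sec}}\le\frac\delta2$. Then, for every collective attack of Eve, $$\frac12\operatorname{tr}\bigl|\rho'_{ABE}-\rho_U\otimes\rho_E\bigr|\le 2R\,n\,e^{-\left(\frac{n_x}{n+n_x}\right)^2 n\,\epsilon_{\mathrm{sec}}^2}.$$ (In particular, the bound holds, with the same $\delta$ and $R$, for every member of any family of such vectors given for infinitely many $n$.) -/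

import Mathlib

open scoped Kronecker

noncomputable section

namespace BB84InfoZ

/-! ### Bits, bit strings and codes -/

/-- The field with two elements. -/
abbrev Bit : Type := ZMod 2

/-- Bit strings of length `t`, as vectors over the field with two elements. Their weight is
`hammingNorm`, and the Hamming distance of two strings is `hammingDist`. -/
abbrev BitString (t : ℕ) : Type := Fin t → Bit

/-- The Hamming distance from the vector `w` to the subspace `V`. -/
def distToSubspace {n : ℕ} (w : BitString n) (V : Submodule Bit (BitString n)) : ℕ :=
  sInf {d : ℕ | ∃ u ∈ V, d = hammingDist w u}

/-- For vectors `v_1, …, v_{r+m}`, the minimum over `r ≤ r' < r + m` of the Hamming distance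
from `v_{r'+1}` to the span of `v_1, …, v_{r'}`. Indices in `Fin` start from `0`, so that
`v (Fin.natAdd r j)` with `j : Fin m` is the vector `v_{r'+1}` with `r' = r + j`. For `m = 0`
the minimum is over the empty set, and the value is `0`. -/
def minDist {n r m : ℕ} (v : Fin (r + m) → BitString n) : ℕ :=
  ⨅ j : Fin m, distToSubspace (v (Fin.natAdd r j))
    (Submodule.span Bit (v '' {l | l < Fin.natAdd r j}))

/-! ### The public parameters of the protocol -/

/-- The public parameters: the numbers of INFO, TEST-Z and TEST-X bits, the error thresholds,
the parity check matrix, the privacy amplification matrix, and Bob's error correction, which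
turns his INFO string and Alice's syndrome into a corrected INFO string. -/
structure Params where
  /-- number of INFO bits -/
  n : ℕ
  /-- number of TEST-Z bits -/
  nz : ℕ
  /-- number of TEST-X bits -/
  nx : ℕ
  /-- length of the syndrome -/
  r : ℕ
  /-- length of the final key -/
  m : ℕ
  /-- error threshold on the TEST-Z bits -/
  paz : ℝ
  /-- error threshold on the TEST-X bits -/
  pax : ℝ
  /-- parity check matrix of the error-correcting code -/
  PC : Matrix (Fin r) (Fin n) Bit
  /-- privacy amplification matrix -/
  PK : Matrix (Fin m) (Fin n) Bit
  /-- error correction: Bob's INFO string and the syndrome give the corrected string -/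
  correct : BitString n → BitString r → BitString n

namespace Params

variable (Q : Params)

/-- The total number `N` of qubits. -/
abbrev N : ℕ := Q.n + Q.nz + Q.nx

/-- The vectors `v_1, …, v_{r+m}`: the rows of `PC` followed by the rows of `PK`. -/
def rows : Fin (Q.r + Q.m) → BitString Q.n := Fin.append Q.PC.row Q.PK.row

/-- The final keys. -/
abbrev Key : Type := BitString Q.m

/-- The partitions `(s, z, b)` of the `N` bits: three `N`-bit strings of weights `n`, `nz`, `nx`
whose sum has weight `N`. -/
abbrev Partition : Type :=
  {P : BitString Q.N × BitString Q.N × BitString Q.N //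
    hammingNorm P.1 = Q.n ∧ hammingNorm P.2.1 = Q.nz ∧ hammingNorm P.2.2 = Q.nx ∧
    hammingNorm (P.1 + P.2.1 + P.2.2) = Q.N}

end Params

/-- The substring of `i` formed by the positions where `s` is `1`, in increasing order. -/
def substring {N k : ℕ} (s : BitString N) (hs : hammingNorm s = k) (i : BitString N) :
    BitString k :=
  fun l => i (Finset.orderEmbOfFin (Finset.univ.filter fun j => s j ≠ 0) hs l)

namespace Params

variable {Q : Params}

/-- The substring of the INFO bits. -/
def info (P : Q.Partition) (i : BitString Q.N) : BitString Q.n :=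
  substring P.1.1 P.2.1 i

/-- The substring of the TEST-Z bits. -/
def testZ (P : Q.Partition) (i : BitString Q.N) : BitString Q.nz :=
  substring P.1.2.1 P.2.2.1 i

/-- The substring of the TEST-X bits. -/
def testX (P : Q.Partition) (i : BitString Q.N) : BitString Q.nx :=
  substring P.1.2.2 P.2.2.2.1 i

/-- The string `b` of bases: the `j`-th qubit is sent and measured in the `x` basis if and only
if `b_j = 1`. -/
def bases (P : Q.Partition) : BitString Q.N := P.1.2.2

/-- The test is passed: the error rates on the TEST-Z bits and on the TEST-X bits are both below
their thresholds, if Alice sends `i` and Bob measures `iB`. -/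
def TestPassed (P : Q.Partition) (i iB : BitString Q.N) : Prop :=
  (hammingNorm (testZ P (i + iB)) : ℝ) / Q.nz ≤ Q.paz ∧
  (hammingNorm (testX P (i + iB)) : ℝ) / Q.nx ≤ Q.pax

/-- The syndrome of an INFO string. -/
def syndrome (Q : Params) (x : BitString Q.n) : BitString Q.r := Matrix.vecMul x Q.PC.transpose

/-- The final key computed from an INFO string. -/
def key (Q : Params) (x : BitString Q.n) : Q.Key := Matrix.vecMul x Q.PK.transpose

/-- The information published on the classical channel: the TEST-Z and TEST-X bits of Alice, the
TEST-Z and TEST-X bits of Bob, the partition, and the syndrome. -/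
abbrev Public (Q : Params) : Type :=
  BitString Q.nz × BitString Q.nx × BitString Q.nz × BitString Q.nx ×
    Q.Partition × BitString Q.r

/-- The published information, if Alice sends `i`, Bob measures `iB`, and `P` is the partition. -/
def published (P : Q.Partition) (i iB : BitString Q.N) : Q.Public :=
  (testZ P i, testX P i, testZ P iB, testX P iB, P, Q.syndrome (info P i))

/-- Alice's final key. -/
def aliceKey (P : Q.Partition) (i : BitString Q.N) : Q.Key := Q.key (info P i)

/-- Bob's final key, computed from his corrected INFO string. -/
def bobKey (P : Q.Partition) (i iB : BitString Q.N) : Q.Key :=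
  Q.key (Q.correct (info P iB) (Q.syndrome (info P i)))

end Params

/-! ### Qubits and collective attacks -/

/-- Coordinates in the computational basis of the qubit state that encodes the bit `i` in the
`z` basis (`b = 0`) or in the `x` basis (`b = 1`). -/
def ket (b i : Bit) : Bit → ℂ :=
  if b = 0 then fun t => if t = i then 1 else 0
  else fun t => if i = 1 ∧ t = 1 then -(1 / (Real.sqrt 2 : ℂ)) else 1 / (Real.sqrt 2 : ℂ)

/-- A collective attack on `N` qubits: to the `j`-th qubit Eve attaches a probe of finite
dimension `dim j` in the pure state `init j`, and applies the unitary `U j` to the compound system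
of the probe and the qubit. -/
structure CollectiveAttack (N : ℕ) where
  dim : Fin N → ℕ
  init : ∀ j, EuclideanSpace ℂ (Fin (dim j))
  init_unit : ∀ j, ‖init j‖ = 1
  U : ∀ j, Matrix.unitaryGroup (Fin (dim j) × Bit) ℂ

namespace CollectiveAttack

variable {N : ℕ} (A : CollectiveAttack N)

/-- Basis labels for the compound system of Eve's `N` probes. -/
abbrev Probes : Type := ∀ j, Fin (A.dim j)

/-- The non-normalized state of the `j`-th probe if the `j`-th qubit is sent in the basis `b` with
the bit `i`, and Bob, measuring in the same basis, obtains the bit `i'`: the vector `E^b_{i i'}` in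
`U (init ⊗ |i⟩) = ∑ i', E^b_{i i'} ⊗ |i'⟩`. -/
def branch (j : Fin N) (b i i' : Bit) : Fin (A.dim j) → ℂ := fun e =>
  ∑ t : Bit, star (ket b i' t) *
    ((A.U j : Matrix (Fin (A.dim j) × Bit) (Fin (A.dim j) × Bit) ℂ).mulVec
      (fun p => A.init j p.1 * ket b i p.2)) (e, t)

/-- The probability that Bob measures `iB` if Alice sends `i` in the bases `b`. -/
def outcomeProb (b i iB : BitString N) : ℝ :=
  ∏ j, ∑ e, ‖A.branch j (b j) (i j) (iB j) e‖ ^ 2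

/-- The non-normalized joint state vector of Eve's probes if Alice sends `i` in the bases `b` and
Bob measures `iB`. -/
def probeVector (b i iB : BitString N) : A.Probes → ℂ :=
  fun e => ∏ j, A.branch j (b j) (i j) (iB j) (e j)

/-- Eve's normalized quantum state (density matrix of her probes) if Alice sends `i` in the
bases `b` and Bob measures `iB`. If this event has probability zero, the value is the zero
matrix. -/
def eveState (b i iB : BitString N) : Matrix A.Probes A.Probes ℂ :=
  ((A.outcomeProb b i iB)⁻¹ : ℂ) •
    Matrix.vecMulVec (A.probeVector b i iB) (star (A.probeVector b i iB))

end CollectiveAttack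

/-! ### Operators -/

open Classical in
/-- The projector onto the basis state with label `a`. -/
def proj {α : Type*} (a : α) : Matrix α α ℂ := Matrix.single a a 1

/-- The partial trace over the first subsystem. -/
def traceFst {α β : Type*} [Fintype α] (M : Matrix (α × β) (α × β) ℂ) : Matrix β β ℂ :=
  Matrix.of fun x y => ∑ a, M (a, x) (a, y)

open Classical in
open scoped MatrixOrder in
/-- The trace norm `tr |M|`, where `|M|` is the positive square root of `M† M`. -/
def traceNorm {α : Type*} [Fintype α] (M : Matrix α α ℂ) : ℝ :=
  (CFC.abs M).trace.re

/-! ### The final states of the protocol -/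

section FinalStates

variable {Q : Params} (A : CollectiveAttack Q.N)

/-- The probability that Alice sends `i`, Bob measures `iB`, and the partition is `P`: the
partition and the string `i` are uniformly random and independent. -/
def jointProb (i iB : BitString Q.N) (P : Q.Partition) : ℝ :=
  1 / (Fintype.card Q.Partition : ℝ) * (1 / 2 ^ Q.N) * A.outcomeProb (Params.bases P) i iB

/-- Labels for the compound system of Alice, Bob and Eve: Alice's and Bob's final keys, and Eve's
system, which consists of her probes and of the published information. -/
abbrev ABE : Type := (Q.Key × Q.Key) × (A.Probes × Q.Public)

open Classical in
/-- The (non-normalized) final state of Alice, Bob and Eve, if Bob holds the key `kB P i iB`. The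
sum is over the events in which the test is passed. -/
def finalStateWith (kB : Q.Partition → BitString Q.N → BitString Q.N → Q.Key) :
    Matrix (ABE A) (ABE A) ℂ :=
  ∑ i : BitString Q.N, ∑ iB : BitString Q.N, ∑ P : Q.Partition,
    if Params.TestPassed P i iB then
      (jointProb A i iB P : ℂ) •
        ((proj (Params.aliceKey P i) ⊗ₖ proj (kB P i iB)) ⊗ₖ
          (A.eveState (Params.bases P) i iB ⊗ₖ proj (Params.published P i iB)))
    else 0

/-- The final state `ρ_ABE` of the protocol: Bob holds the key that he has computed. -/
def rhoABE : Matrix (ABE A) (ABE A) ℂ :=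
  finalStateWith A fun P i iB => Params.bobKey P i iB

/-- The intermediate state `ρ'_ABE`: Bob holds Alice's final key. -/
def rhoABEprime : Matrix (ABE A) (ABE A) ℂ :=
  finalStateWith A fun P i _ => Params.aliceKey P i

/-- Eve's state `ρ_E`: the partial trace of `ρ_ABE` over the systems of Alice and Bob. -/
def rhoE : Matrix (A.Probes × Q.Public) (A.Probes × Q.Public) ℂ := traceFst (rhoABE A)

/-- The ideal state `ρ_U`: a uniformly random key, the same for Alice and Bob. -/
def rhoU (Q : Params) : Matrix (Q.Key × Q.Key) (Q.Key × Q.Key) ℂ :=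
  (1 / 2 ^ Q.m : ℂ) • ∑ k : Q.Key, proj k ⊗ₖ proj k

end FinalStates

end BB84InfoZ

end

/-!
The trace distance is the value of `tr (M W)` for some `W` of norm at most one, and `W` acts on
Eve's probes through one operator for each value of the key and of the published data. A hybrid
argument replaces the key bits by uniform ones one at a time, so that it remains to bound, for each
key bit, the expectation of an operator that changes sign with that bit, that is, with a parity `v`
of the INFO bits, while Eve knows some further parities, whose span is `V`.

Seen in the `x` basis, the INFO bits are Fourier dual to the bits that Alice and Bob hold. In this
picture an operator that changes sign with `v` only connects error strings whose difference lies in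
`v + V`, and hence has weight at least `d_{r,m}`. Two strings of weight less than `d_{r,m} / 2` are
therefore never connected, and by the Cauchy–Schwarz inequality the expectation is at most a
multiple of the square root of the probability that the INFO bits have at least `d_{r,m} / 2`
errors in the `x` basis although the test is passed. The INFO bits are a uniformly random subset of
the INFO and TEST-X bits in the `x` basis, so Hoeffding's inequality for sampling without
replacement bounds this probability.
-/

noncomputable section

namespace BB84InfoZ

/-! ### Sampling without replacement -/

open MeasureTheory ProbabilityTheory in
theorem one_add_mul_exp_sub_one_le {p : ℝ} (hp : p ∈ Set.Icc 0 1) (t : ℝ) :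
    1 + p * (Real.exp t - 1) ≤ Real.exp (t * p + t ^ 2 / 8) := by
  have hmem : ∀ᵐ x ∂bernoulliMeasure (1 : ℝ) 0 ⟨p, hp⟩, id x ∈ Set.Icc (0 : ℝ) 1 := by
    rw [bernoulliMeasure_def]
    exact ae_add_measure_iff.2
      ⟨Measure.ae_smul_measure (by simp [ae_dirac_eq]) _,
        Measure.ae_smul_measure (by simp [ae_dirac_eq]) _⟩
  have hmgf := (hasSubgaussianMGF_of_mem_Icc aemeasurable_id hmem).mgf_le t
  simp only [mgf, integral_bernoulliMeasure] at hmgf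
  have half_sq : (((‖(1 : ℝ) - 0‖₊ / 2) ^ 2 : NNReal) : ℝ) * t ^ 2 / 2 = t ^ 2 / 8 := by
    norm_num
    ring
  rw [half_sq] at hmgf
  calc 1 + p * (Real.exp t - 1)
      = Real.exp (t * p) * (p * Real.exp (t * (1 - p)) + (1 - p) * Real.exp (-(t * p))) := by
        rw [mul_add, mul_left_comm, mul_left_comm _ (1 - p), ← Real.exp_add, ← Real.exp_add,
          show t * p + t * (1 - p) = t by ring, add_neg_cancel, Real.exp_zero]
        ring
    _ ≤ Real.exp (t * p) * Real.exp (t ^ 2 / 8) := by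
        gcongr
        simpa using hmgf
    _ = Real.exp (t * p + t ^ 2 / 8) := (Real.exp_add _ _).symm

theorem choose_mul_pow_le {K M : ℕ} (hKM : K ≤ M) (k : ℕ) :
    K.choose k * M ^ k ≤ M.choose k * K ^ k := by
  have descFactorial_le : K.descFactorial k * M ^ k ≤ M.descFactorial k * K ^ k := by
    rw [Nat.descFactorial_eq_prod_range, Nat.descFactorial_eq_prod_range, Finset.pow_eq_prod_const,
      Finset.pow_eq_prod_const, ← Finset.prod_mul_distrib, ← Finset.prod_mul_distrib]
    refine Finset.prod_le_prod' fun i _ => ?_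
    rw [Nat.sub_mul, Nat.sub_mul, mul_comm M K]
    exact Nat.sub_le_sub_left (Nat.mul_le_mul_left i hKM) _
  simp only [Nat.descFactorial_eq_factorial_mul_choose, mul_assoc] at descFactorial_le
  exact Nat.le_of_mul_le_mul_left descFactorial_le k.factorial_pos

section Sampling

variable {α : Type*} [DecidableEq α] {U C : Finset α} {n k : ℕ}

theorem sum_choose_card_inter (hCU : C ⊆ U) (hkn : k ≤ n) :
    ∑ S ∈ U.powersetCard n, (S ∩ C).card.choose k =
      C.card.choose k * (U.card - k).choose (n - k) := by
  have choose_eq (S : Finset α) :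
      (S ∩ C).card.choose k = ((C.powersetCard k).filter (· ⊆ S)).card := by
    rw [← Finset.card_powersetCard]
    congr 1
    ext T
    simp only [Finset.mem_powersetCard, Finset.mem_filter, Finset.subset_inter_iff]
    tauto
  calc ∑ S ∈ U.powersetCard n, (S ∩ C).card.choose k
      = ∑ S ∈ U.powersetCard n, ((C.powersetCard k).filter (· ⊆ S)).card :=
        Finset.sum_congr rfl fun S _ => choose_eq S
    _ = ∑ T ∈ C.powersetCard k, ((U.powersetCard n).filter (T ⊆ ·)).card := by
        simp only [Finset.card_filter]
        exact Finset.sum_comm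
    _ = ∑ _ ∈ C.powersetCard k, (U.card - k).choose (n - k) := by
        refine Finset.sum_congr rfl fun _ hT => ?_
        obtain ⟨hTC, rfl⟩ := Finset.mem_powersetCard.1 hT
        exact Finset.card_filter_powersetCard_subset _ _ _ (hTC.trans hCU) hkn
    _ = C.card.choose k * (U.card - k).choose (n - k) := by
        rw [Finset.sum_const, Finset.card_powersetCard, smul_eq_mul]

theorem sum_choose_card_inter_le (hCU : C ⊆ U) (hkn : k ≤ n) :
    ∑ S ∈ U.powersetCard n, ((S ∩ C).card.choose k : ℝ) ≤
      U.card.choose n * (n.choose k * (C.card / U.card : ℝ) ^ k) := by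
  have choose_le : (C.card.choose k : ℝ) ≤ U.card.choose k * (C.card / U.card : ℝ) ^ k := by
    obtain rfl | hU := U.eq_empty_or_nonempty
    · obtain rfl := Finset.subset_empty.1 hCU
      cases k <;> simp
    · have : 0 < U.card := hU.card_pos
      rw [div_pow, ← mul_div_assoc, le_div_iff₀ (by positivity)]
      exact_mod_cast choose_mul_pow_le (Finset.card_le_card hCU) k
  have choose_mul : (U.card.choose n : ℝ) * n.choose k =
      U.card.choose k * (U.card - k).choose (n - k) := by
    exact_mod_cast Nat.choose_mul hkn
  calc ∑ S ∈ U.powersetCard n, ((S ∩ C).card.choose k : ℝ)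
      = C.card.choose k * (U.card - k).choose (n - k) := by
        exact_mod_cast sum_choose_card_inter hCU hkn
    _ ≤ U.card.choose k * (C.card / U.card : ℝ) ^ k * (U.card - k).choose (n - k) := by gcongr
    _ = U.card.choose n * (n.choose k * (C.card / U.card : ℝ) ^ k) := by
        rw [← mul_assoc (U.card.choose n : ℝ), choose_mul]; ring

/-- The moment generating function of a hypergeometric variable is dominated by that of the
binomial variable with the same mean because its factorial moments are. -/
theorem sum_one_add_pow_card_inter_le (hCU : C ⊆ U) {y : ℝ} (hy : 0 ≤ y) :
    ∑ S ∈ U.powersetCard n, (1 + y) ^ (S ∩ C).card ≤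
      U.card.choose n * (1 + C.card / U.card * y) ^ n := by
  have binomial {x : ℝ} {j : ℕ} (hj : j ≤ n) :
      (1 + x) ^ j = ∑ k ∈ Finset.range (n + 1), (j.choose k : ℝ) * x ^ k := by
    rw [add_comm, add_pow]
    simp only [one_pow, mul_one]
    simp only [mul_comm (x ^ _)]
    refine Finset.sum_subset (Finset.range_subset_range.2 (by omega)) fun k _ hk => ?_
    rw [Nat.choose_eq_zero_of_lt (by simpa using hk), Nat.cast_zero, zero_mul]
  calc ∑ S ∈ U.powersetCard n, (1 + y) ^ (S ∩ C).card
      = ∑ k ∈ Finset.range (n + 1),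
          (∑ S ∈ U.powersetCard n, ((S ∩ C).card.choose k : ℝ)) * y ^ k := by
        simp only [Finset.sum_mul]
        rw [Finset.sum_comm]
        refine Finset.sum_congr rfl fun S hS => binomial ?_
        exact (Finset.card_le_card Finset.inter_subset_left).trans
          (Finset.mem_powersetCard.1 hS).2.le
    _ ≤ ∑ k ∈ Finset.range (n + 1),
          U.card.choose n * (n.choose k * (C.card / U.card : ℝ) ^ k) * y ^ k := by
        gcongr with k hk
        exact sum_choose_card_inter_le hCU (Finset.mem_range_succ_iff.1 hk)
    _ = U.card.choose n * (1 + C.card / U.card * y) ^ n := by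
        simp only [binomial le_rfl, Finset.mul_sum, mul_pow, mul_assoc]

theorem card_filter_add_le_card_inter_le (hCU : C ⊆ U) {t : ℝ} (ht : 0 ≤ t) :
    (((U.powersetCard n).filter fun S =>
        n * (C.card / U.card + t) ≤ (S ∩ C).card).card : ℝ) ≤
      U.card.choose n * Real.exp (-2 * n * t ^ 2) := by
  set p : ℝ := C.card / U.card
  have hp : p ∈ Set.Icc 0 1 :=
    ⟨by positivity, div_le_one_of_le₀ (by exact_mod_cast Finset.card_le_card hCU) (by positivity)⟩
  have hexp : 0 ≤ Real.exp (4 * t) - 1 := sub_nonneg.2 (Real.one_le_exp (by positivity))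
  have markov : (((U.powersetCard n).filter fun S => n * (p + t) ≤ (S ∩ C).card).card : ℝ) *
      Real.exp (4 * t * (n * (p + t))) ≤
        ∑ S ∈ U.powersetCard n, (1 + (Real.exp (4 * t) - 1)) ^ (S ∩ C).card := by
    rw [← nsmul_eq_mul, ← Finset.sum_const]
    refine (Finset.sum_le_sum fun S hS => ?_).trans
      (Finset.sum_le_sum_of_subset_of_nonneg (Finset.filter_subset _ _) fun S _ _ => by positivity)
    rw [add_sub_cancel, ← Real.exp_nat_mul, mul_comm _ (4 * t)]
    gcongr
    exact (Finset.mem_filter.1 hS).2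
  refine le_of_mul_le_mul_right (markov.trans ?_) (Real.exp_pos (4 * t * (n * (p + t))))
  calc ∑ S ∈ U.powersetCard n, (1 + (Real.exp (4 * t) - 1)) ^ (S ∩ C).card
      ≤ U.card.choose n * (1 + p * (Real.exp (4 * t) - 1)) ^ n :=
        sum_one_add_pow_card_inter_le hCU hexp
    _ ≤ U.card.choose n * Real.exp (4 * t * p + (4 * t) ^ 2 / 8) ^ n := by
        have := hp.1
        gcongr
        exact one_add_mul_exp_sub_one_le hp (4 * t)
    _ = U.card.choose n * Real.exp (-2 * n * t ^ 2) * Real.exp (4 * t * (n * (p + t))) := by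
        rw [mul_assoc (U.card.choose n : ℝ), ← Real.exp_add, ← Real.exp_nat_mul]; ring_nf

end Sampling

/-! ### Operator norm and trace norm of matrices -/

section Norm

open scoped Matrix Matrix.Norms.L2Operator

section OperatorNorm

variable {α β : Type*} [Fintype α] [Fintype β] [DecidableEq β]

theorem l2_opNorm_le_one_of_conjTranspose_mul_self {W : Matrix α β ℂ} (hW : Wᴴ * W = 1) :
    ‖W‖ ≤ 1 := by
  have norm_one_le : ‖(1 : Matrix β β ℂ)‖ ≤ 1 := by
    rw [Matrix.cstar_norm_def, map_one]
    exact ContinuousLinearMap.norm_id_le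
  rw [← hW, Matrix.l2_opNorm_conjTranspose_mul_self] at norm_one_le
  nlinarith [norm_nonneg W]

variable [DecidableEq α]

theorem l2_opNorm_submatrix_le (W : Matrix α α ℂ) {f g : β → α} (hf : f.Injective)
    (hg : g.Injective) : ‖W.submatrix f g‖ ≤ ‖W‖ := by
  have isometry {h : β → α} (hh : h.Injective) :
      ‖(1 : Matrix α α ℂ).submatrix id h‖ ≤ 1 := by
    refine l2_opNorm_le_one_of_conjTranspose_mul_self ?_
    rw [Matrix.conjTranspose_submatrix, Matrix.conjTranspose_one,
      ← Matrix.submatrix_mul _ _ _ _ _ Function.bijective_id, mul_one, Matrix.submatrix_one h hh]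
  have factor : W.submatrix f g =
      ((1 : Matrix α α ℂ).submatrix id f)ᴴ * W * (1 : Matrix α α ℂ).submatrix id g := by
    rw [Matrix.conjTranspose_submatrix, Matrix.conjTranspose_one]
    nth_rewrite 2 [← Matrix.submatrix_id_id W]
    rw [← Matrix.submatrix_mul _ _ _ _ _ Function.bijective_id,
      ← Matrix.submatrix_mul _ _ _ _ _ Function.bijective_id, one_mul, mul_one]
  calc ‖W.submatrix f g‖
      ≤ ‖((1 : Matrix α α ℂ).submatrix id f)ᴴ‖ * ‖W‖ * ‖(1 : Matrix α α ℂ).submatrix id g‖ := by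
        rw [factor]
        exact (Matrix.l2_opNorm_mul _ _).trans
          (mul_le_mul_of_nonneg_right (Matrix.l2_opNorm_mul _ _) (norm_nonneg _))
    _ ≤ 1 * ‖W‖ * 1 := by
        rw [Matrix.l2_opNorm_conjTranspose]
        gcongr
        exacts [isometry hf, isometry hg]
    _ = ‖W‖ := by ring

theorem trace_vecMulVec_star_mul (φ : α → ℂ) (W : Matrix α α ℂ) :
    (Matrix.vecMulVec φ (star φ) * W).trace =
      inner ℂ (WithLp.toLp 2 φ) (Matrix.toEuclideanCLM (𝕜 := ℂ) W (WithLp.toLp 2 φ)) := by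
  rw [Matrix.vecMulVec_mul, Matrix.trace_vecMulVec, Matrix.toEuclideanCLM_toLp,
    EuclideanSpace.inner_toLp_toLp, dotProduct_comm, ← Matrix.dotProduct_mulVec, dotProduct_comm]

end OperatorNorm

open scoped MatrixOrder in
theorem exists_norm_le_one_traceNorm_eq {α : Type*} [Fintype α] [DecidableEq α]
    {M : Matrix α α ℂ} (hM : M.IsHermitian) :
    ∃ W : Matrix α α ℂ, ‖W‖ ≤ 1 ∧ traceNorm M = (M * W).trace.re := by
  have hsa : IsSelfAdjoint M := hM
  let sign : ℝ → ℝ := fun x => if 0 ≤ x then 1 else -1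
  have hsign : ContinuousOn sign (spectrum ℝ M) := M.finite_real_spectrum.continuousOn sign
  refine ⟨cfc sign M, l2_opNorm_le_one_of_conjTranspose_mul_self ?_, ?_⟩
  · have hcfc : (cfc sign M)ᴴ = cfc sign M := IsSelfAdjoint.cfc (f := sign) (a := M)
    rw [hcfc, ← cfc_mul sign sign M hsign hsign, ← cfc_one ℝ M]
    refine cfc_congr fun x _ => ?_
    simp only [sign]
    split_ifs <;> simp
  · have habs : CFC.abs M = M * cfc sign M := by
      rw [CFC.abs_eq_cfc_norm M hsa]
      nth_rewrite 2 [← cfc_id' ℝ M hsa]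
      rw [← cfc_mul _ sign M (by fun_prop) hsign]
      refine cfc_congr fun x _ => ?_
      simp only [sign]
      split_ifs with h
      · simp [abs_of_nonneg h]
      · simp [abs_of_neg (not_le.1 h)]
    rw [traceNorm, ← habs]

end Norm

/-! ### Characters and the Walsh–Hadamard transform -/

theorem hammingNorm_add_le {n : ℕ} (a b : BitString n) :
    hammingNorm (a + b) ≤ hammingNorm a + hammingNorm b := by
  simpa [hammingDist_eq_hammingNorm, ZModModule.neg_eq_self] using hammingDist_triangle a 0 b

theorem distToSubspace_le_hammingNorm {n : ℕ} {v w : BitString n}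
    {V : Submodule Bit (BitString n)} (h : w + v ∈ V) : distToSubspace v V ≤ hammingNorm w := by
  refine Nat.sInf_le ⟨w + v, h, ?_⟩
  rw [hammingDist_eq_hammingNorm, ZModModule.neg_eq_self, add_left_comm, ZModModule.add_self,
    add_zero]

theorem exists_dotProduct_eq_one {n : ℕ} {V : Submodule Bit (BitString n)} {w : BitString n}
    (hw : w ∉ V) : ∃ x : BitString n, (∀ u ∈ V, x ⬝ᵥ u = 0) ∧ x ⬝ᵥ w = 1 := by
  obtain ⟨f, hfw, hfV⟩ := Submodule.exists_le_ker_of_notMem hw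
  obtain ⟨x, rfl⟩ := (dotProductEquiv Bit (Fin n)).surjective f
  exact ⟨x, fun u hu => hfV hu, Fin.eq_one_of_ne_zero _ hfw⟩

/-- The nontrivial character `a ↦ (-1) ^ a` of the field with two elements. -/
def bitChar : AddChar Bit ℂ := AddChar.zmodChar 2 (ζ := -1) (by norm_num)

@[simp] theorem bitChar_one : bitChar 1 = -1 := by
  rw [bitChar, AddChar.zmodChar_apply, ZMod.val_one, pow_one]

@[simp] theorem conj_bitChar (a : Bit) : (starRingEnd ℂ) (bitChar a) = bitChar a := by
  rw [bitChar, AddChar.zmodChar_apply, map_pow, map_neg, map_one]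

theorem sum_eq_zero_of_add_eq_neg {G : Type*} [AddGroup G] [Fintype G] {f : G → ℂ} (a : G)
    (hf : ∀ x, f (x + a) = -f x) : ∑ x, f x = 0 := by
  have shift := Equiv.sum_comp (Equiv.addRight a) f
  simp only [Equiv.coe_addRight, hf, Finset.sum_neg_distrib] at shift
  exact neg_eq_self.1 shift

theorem sum_bitChar_dotProduct {n : ℕ} (w : BitString n) :
    ∑ x : BitString n, bitChar (x ⬝ᵥ w) = if w = 0 then 2 ^ n else 0 := by
  split_ifs with hw
  · simp [hw]
  · obtain ⟨x₀, -, hx₀⟩ := exists_dotProduct_eq_one (V := ⊥) hw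
    refine sum_eq_zero_of_add_eq_neg x₀ fun x => ?_
    rw [add_dotProduct, AddChar.map_add_eq_mul, hx₀, bitChar_one, mul_neg_one]

/-- The unnormalized Walsh–Hadamard transform of a function on bit strings: the Fourier transform
of the group of bit strings, which is identified with its dual by the pairing `⬝ᵥ`. -/
def walshHadamard {n : ℕ} {M : Type*} [AddCommMonoid M] [Module ℂ M] (f : BitString n → M)
    (x : BitString n) : M :=
  ∑ s, bitChar (x ⬝ᵥ s) • f s

theorem walshHadamard_add {n : ℕ} {M : Type*} [AddCommMonoid M] [Module ℂ M]
    (f g : BitString n → M) :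
    walshHadamard (f + g) = walshHadamard f + walshHadamard g := by
  ext x
  simp only [walshHadamard, Pi.add_apply, smul_add, Finset.sum_add_distrib]

section Parity

variable {n : ℕ} {H : Type*} [NormedAddCommGroup H] [InnerProductSpace ℂ H]

theorem inner_walshHadamard (T : H →L[ℂ] H) (f g : BitString n → H) (x : BitString n) :
    inner ℂ (walshHadamard f x) (T (walshHadamard g x)) =
      ∑ s, ∑ t, bitChar (x ⬝ᵥ (s + t)) * inner ℂ (f s) (T (g t)) := by
  rw [walshHadamard, sum_inner]
  simp only [walshHadamard, map_sum, map_smul, inner_sum, inner_smul_left, inner_smul_right,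
    conj_bitChar, dotProduct_add, AddChar.map_add_eq_mul]
  refine Finset.sum_congr rfl fun s _ => Finset.sum_congr rfl fun t _ => ?_
  ring

theorem sum_inner_walshHadamard (T : H →L[ℂ] H) (f g : BitString n → H) :
    ∑ x, inner ℂ (walshHadamard f x) (T (walshHadamard g x)) =
      2 ^ n * ∑ s, inner ℂ (f s) (T (g s)) := by
  simp only [inner_walshHadamard]
  rw [Finset.sum_comm, Finset.mul_sum]
  refine Finset.sum_congr rfl fun s _ => ?_
  rw [Finset.sum_comm]
  simp only [← Finset.sum_mul, sum_bitChar_dotProduct, add_eq_zero_iff_eq_neg,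
    ZModModule.neg_eq_self, ite_mul, zero_mul, Finset.sum_ite_eq, Finset.mem_univ, if_true]

theorem sum_norm_sq_walshHadamard (f : BitString n → H) :
    ∑ x, ‖walshHadamard f x‖ ^ 2 = 2 ^ n * ∑ s, ‖f s‖ ^ 2 := by
  have parseval := sum_inner_walshHadamard (ContinuousLinearMap.id ℂ H) f f
  simp only [ContinuousLinearMap.id_apply, inner_self_eq_norm_sq_to_K, Complex.coe_algebraMap]
    at parseval
  exact_mod_cast parseval

theorem sum_sum_inner_walshHadamard_walshHadamard (K : BitString n → H →L[ℂ] H)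
    (f : BitString n → BitString n → H) :
    ∑ x, ∑ y, inner ℂ (walshHadamard (fun t => walshHadamard (f · t) x) y)
        (K x (walshHadamard (fun t => walshHadamard (f · t) x) y)) =
      2 ^ n * ∑ t, ∑ x, inner ℂ (walshHadamard (f · t) x) (K x (walshHadamard (f · t) x)) := by
  simp only [sum_inner_walshHadamard, ← Finset.mul_sum]
  rw [Finset.sum_comm]

variable {C : ℝ} {K : BitString n → H →L[ℂ] H}

theorem norm_sum_inner_walshHadamard_le (hK : ∀ x, ‖K x‖ ≤ C) (f g : BitString n → H) :
    ‖∑ x, inner ℂ (walshHadamard f x) (K x (walshHadamard g x))‖ ≤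
      C * 2 ^ n * (√(∑ s, ‖f s‖ ^ 2) * √(∑ s, ‖g s‖ ^ 2)) := by
  have hC : 0 ≤ C := (norm_nonneg _).trans (hK 0)
  calc ‖∑ x, inner ℂ (walshHadamard f x) (K x (walshHadamard g x))‖
      ≤ ∑ x, C * (√(‖walshHadamard f x‖ ^ 2) * √(‖walshHadamard g x‖ ^ 2)) := by
        refine norm_sum_le_of_le _ fun x _ => (norm_inner_le_norm _ _).trans ?_
        rw [Real.sqrt_sq (norm_nonneg _), Real.sqrt_sq (norm_nonneg _), mul_left_comm]
        gcongr
        exact (K x).le_of_opNorm_le (hK x) _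
    _ ≤ C * (√(∑ x, ‖walshHadamard f x‖ ^ 2) * √(∑ x, ‖walshHadamard g x‖ ^ 2)) := by
        rw [← Finset.mul_sum]
        gcongr
        exact Real.sum_sqrt_mul_sqrt_le _ (fun _ => sq_nonneg _) fun _ => sq_nonneg _
    _ = C * 2 ^ n * (√(∑ s, ‖f s‖ ^ 2) * √(∑ s, ‖g s‖ ^ 2)) := by
        rw [sum_norm_sq_walshHadamard, sum_norm_sq_walshHadamard, Real.sqrt_mul (by positivity),
          Real.sqrt_mul (by positivity), mul_mul_mul_comm, Real.mul_self_sqrt (by positivity),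
          mul_assoc]

variable {V : Submodule Bit (BitString n)} {v : BitString n}
  (hodd : ∀ x x₀, (∀ u ∈ V, x₀ ⬝ᵥ u = 0) → K (x + x₀) = bitChar (x₀ ⬝ᵥ v) • K x)
include hodd

theorem sum_bitChar_mul_inner_eq_zero {w : BitString n} (hw : w + v ∉ V) (φ ψ : H) :
    ∑ x, bitChar (x ⬝ᵥ w) * inner ℂ φ (K x ψ) = 0 := by
  obtain ⟨x₀, horth, hx₀⟩ := exists_dotProduct_eq_one hw
  have hneg : bitChar (x₀ ⬝ᵥ w) * bitChar (x₀ ⬝ᵥ v) = -1 := by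
    rw [← AddChar.map_add_eq_mul, ← dotProduct_add, hx₀, bitChar_one]
  refine sum_eq_zero_of_add_eq_neg x₀ fun x => ?_
  rw [hodd x x₀ horth, add_dotProduct, AddChar.map_add_eq_mul, smul_apply,
    inner_smul_right]
  linear_combination bitChar (x ⬝ᵥ w) * inner ℂ φ (K x ψ) * hneg

theorem sum_inner_walshHadamard_eq_zero (c : BitString n) {f : BitString n → H}
    (hf : ∀ s, distToSubspace v V ≤ 2 * hammingNorm (s + c) → f s = 0) :
    ∑ x, inner ℂ (walshHadamard f x) (K x (walshHadamard f x)) = 0 := by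
  simp only [inner_walshHadamard]
  rw [Finset.sum_comm]
  refine Finset.sum_eq_zero fun s _ => ?_
  rw [Finset.sum_comm]
  refine Finset.sum_eq_zero fun t _ => ?_
  by_cases hs : distToSubspace v V ≤ 2 * hammingNorm (s + c)
  · simp [hf s hs]
  by_cases ht : distToSubspace v V ≤ 2 * hammingNorm (t + c)
  · simp [hf t ht]
  refine sum_bitChar_mul_inner_eq_zero hodd (fun hmem => ?_) _ _
  have hdist := distToSubspace_le_hammingNorm hmem
  have htriangle := hammingNorm_add_le (s + c) (t + c)
  rw [add_add_add_comm, ZModModule.add_self, add_zero] at htriangle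
  omega

theorem norm_sum_inner_walshHadamard_le_of_odd (hK : ∀ x, ‖K x‖ ≤ C) (c : BitString n)
    (f : BitString n → H) :
    ‖∑ x, inner ℂ (walshHadamard f x) (K x (walshHadamard f x))‖ ≤
      2 * C * 2 ^ n * (√(∑ s, ‖f s‖ ^ 2) *
        √(∑ s with distToSubspace v V ≤ 2 * hammingNorm (s + c), ‖f s‖ ^ 2)) := by
  have hC : 0 ≤ C := (norm_nonneg _).trans (hK 0)
  let far : Set (BitString n) := {s | distToSubspace v V ≤ 2 * hammingNorm (s + c)}
  let bad := far.indicator f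
  let good := farᶜ.indicator f
  have hsplit : f = bad + good := (far.indicator_self_add_compl f).symm
  have hvanish : ∑ x, inner ℂ (walshHadamard good x) (K x (walshHadamard good x)) = 0 :=
    sum_inner_walshHadamard_eq_zero hodd c fun s hs =>
      Set.indicator_of_notMem (s := farᶜ) (fun h => h hs) f
  have hdecomp : ∑ x, inner ℂ (walshHadamard f x) (K x (walshHadamard f x)) =
      ∑ x, inner ℂ (walshHadamard f x) (K x (walshHadamard bad x)) +
      ∑ x, inner ℂ (walshHadamard bad x) (K x (walshHadamard good x)) := by
    rw [← add_zero (∑ x, inner ℂ (walshHadamard bad x) _), ← hvanish, ← Finset.sum_add_distrib,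
      ← Finset.sum_add_distrib]
    refine Finset.sum_congr rfl fun x _ => ?_
    rw [← inner_add_left, ← Pi.add_apply, ← walshHadamard_add, ← hsplit, ← inner_add_right,
      ← map_add, ← Pi.add_apply, ← walshHadamard_add, ← hsplit]
  have hbad : ∑ s with distToSubspace v V ≤ 2 * hammingNorm (s + c), ‖f s‖ ^ 2 =
      ∑ s, ‖bad s‖ ^ 2 := by
    rw [Finset.sum_filter]
    refine Finset.sum_congr rfl fun s _ => ?_
    simp only [bad, Set.indicator_apply, far, Set.mem_ofPred_eq]
    split_ifs <;> simp
  have hgood : ∑ s, ‖good s‖ ^ 2 ≤ ∑ s, ‖f s‖ ^ 2 := by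
    gcongr
    exact norm_indicator_le_norm_self f _
  rw [hdecomp, hbad]
  calc _ ≤ C * 2 ^ n * (√(∑ s, ‖f s‖ ^ 2) * √(∑ s, ‖bad s‖ ^ 2)) +
        C * 2 ^ n * (√(∑ s, ‖bad s‖ ^ 2) * √(∑ s, ‖f s‖ ^ 2)) := by
        refine (norm_add_le _ _).trans (add_le_add
          (norm_sum_inner_walshHadamard_le hK _ _)
          ((norm_sum_inner_walshHadamard_le hK _ _).trans ?_))
        gcongr
    _ = _ := by ring

theorem norm_sum_sum_inner_walshHadamard_walshHadamard_le (hK : ∀ x, ‖K x‖ ≤ C)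
    (f : BitString n → BitString n → H) :
    ‖∑ x, ∑ y, inner ℂ (walshHadamard (fun t => walshHadamard (f · t) x) y)
        (K x (walshHadamard (fun t => walshHadamard (f · t) x) y))‖ ≤
      2 * C * (2 ^ n * 2 ^ n) * (√(∑ s, ∑ t, ‖f s t‖ ^ 2) *
        √(∑ s, ∑ t with distToSubspace v V ≤ 2 * hammingNorm (s + t), ‖f s t‖ ^ 2)) := by
  have hC : 0 ≤ C := (norm_nonneg _).trans (hK 0)
  simp only [Finset.sum_filter]
  rw [sum_sum_inner_walshHadamard_walshHadamard, norm_mul, norm_pow, Complex.norm_ofNat,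
    mul_left_comm (2 * C), mul_assoc (2 ^ n),
    Finset.sum_comm (f := fun s t => ‖f s t‖ ^ 2),
    Finset.sum_comm (f := fun s t => if distToSubspace v V ≤ 2 * hammingNorm (s + t)
      then ‖f s t‖ ^ 2 else 0)]
  simp only [← Finset.sum_filter]
  gcongr
  calc ‖∑ t, ∑ x, inner ℂ (walshHadamard (f · t) x) (K x (walshHadamard (f · t) x))‖
      ≤ ∑ t, 2 * C * 2 ^ n * (√(∑ s, ‖f s t‖ ^ 2) *
          √(∑ s with distToSubspace v V ≤ 2 * hammingNorm (s + t), ‖f s t‖ ^ 2)) :=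
        norm_sum_le_of_le _ fun t _ => norm_sum_inner_walshHadamard_le_of_odd hodd hK t (f · t)
    _ ≤ _ := by
        rw [← Finset.mul_sum]
        gcongr
        exact Real.sum_sqrt_mul_sqrt_le _ (fun _ => by positivity) fun _ => by positivity

end Parity

theorem walshHadamard_apply {n : ℕ} {ι : Type*} (f : BitString n → EuclideanSpace ℂ ι)
    (x : BitString n) (e : ι) : walshHadamard f x e = walshHadamard (fun s => f s e) x := by
  simp [walshHadamard]

theorem bitChar_sum {ι : Type*} (s : Finset ι) (f : ι → Bit) :
    bitChar (∑ i ∈ s, f i) = ∏ i ∈ s, bitChar (f i) :=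
  map_prod bitChar.toMonoidHom (fun i => Multiplicative.ofAdd (f i)) s

theorem walshHadamard_mul_prod {n : ℕ} (c : ℂ) (f : Fin n → Bit → ℂ) (x : BitString n) :
    walshHadamard (fun s => c * ∏ l, f l (s l)) x = c * ∏ l, ∑ a, bitChar (x l * a) * f l a := by
  rw [Finset.prod_univ_sum, Fintype.piFinset_univ, Finset.mul_sum]
  refine Finset.sum_congr rfl fun s _ => ?_
  rw [dotProduct, bitChar_sum, Finset.prod_mul_distrib, smul_eq_mul]
  ring

/-! ### The hybrid argument over the bits of the key -/

theorem card_bitString (t : ℕ) : Fintype.card (BitString t) = 2 ^ t := by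
  rw [Fintype.card_fun, ZMod.card, Fintype.card_fin]

theorem bit_eq_zero_or_one : ∀ a : Bit, a = 0 ∨ a = 1 := by decide

namespace BitString

/-- The string obtained from `k` by setting the first `l` bits to zero. -/
def tail {m : ℕ} (l : ℕ) (k : BitString m) : BitString m := fun j => if j < l then 0 else k j

variable {m : ℕ}

theorem tail_add (l : ℕ) (k k' : BitString m) : tail l (k + k') = tail l k + tail l k' := by
  ext j
  simp only [tail, Pi.add_apply]
  split_ifs <;> simp

theorem tail_eq_self {l : ℕ} {k : BitString m} (hk : ∀ j : Fin m, j < l → k j = 0) :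
    tail l k = k := by
  ext j
  simp only [tail]
  split_ifs with hj
  exacts [(hk j hj).symm, rfl]

theorem tail_of_le {l : ℕ} (hl : m ≤ l) (k : BitString m) : tail l k = 0 :=
  funext fun j => if_pos (j.2.trans_le hl)

theorem tail_eq_add_single (l : Fin m) (k : BitString m) :
    tail l k = tail (l + 1) k + Pi.single l (k l) := by
  ext j
  rcases lt_trichotomy j l with hj | rfl | hj
  · rw [Pi.add_apply, Pi.single_eq_of_ne hj.ne]
    simp [tail, show (j : ℕ) < l from hj, show (j : ℕ) < l + 1 by omega]
  · simp [tail]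
  · rw [Pi.add_apply, Pi.single_eq_of_ne hj.ne']
    simp [tail, show ¬(j : ℕ) < l by omega, show ¬(j : ℕ) < l + 1 by omega]

end BitString

section Hybrid

open BitString

variable {m : ℕ} {M : Type*}

/-- The average of `g` over the strings that have the same first `l` bits as `k`. -/
def tailAverage [AddCommMonoid M] [Module ℂ M] (g : BitString m → M) (l : ℕ) (k : BitString m) :
    M :=
  (1 / 2 ^ m : ℂ) • ∑ k', g (k + tail l k')

/-- The component of `g` that depends on the first `l + 1` bits and averages to zero over the bit
with index `l`. -/
def hybridDiff [AddCommGroup M] [Module ℂ M] (g : BitString m → M) (l : ℕ) (k : BitString m) :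
    M :=
  tailAverage g (l + 1) k - tailAverage g l k

section Module

variable [AddCommGroup M] [Module ℂ M] (g : BitString m → M)

theorem tailAverage_zero (k : BitString m) :
    tailAverage g 0 k = (1 / 2 ^ m : ℂ) • ∑ k', g k' := by
  have htail (k' : BitString m) : tail 0 k' = k' := tail_eq_self fun j hj => absurd hj (by omega)
  simp only [tailAverage, htail]
  exact congrArg _ (Equiv.sum_comp (Equiv.addLeft k) g)

theorem tailAverage_length (k : BitString m) : tailAverage g m k = g k := by
  simp only [tailAverage, tail_of_le le_rfl, add_zero, Finset.sum_const, Finset.card_univ,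
    card_bitString]
  rw [← Nat.cast_smul_eq_nsmul ℂ, smul_smul]
  simp

theorem sum_hybridDiff (k : BitString m) :
    ∑ l : Fin m, hybridDiff g l k = g k - (1 / 2 ^ m : ℂ) • ∑ k', g k' := by
  rw [Fin.sum_univ_eq_sum_range fun l => hybridDiff g l k]
  simp only [hybridDiff]
  rw [Finset.sum_range_sub fun l => tailAverage g l k, tailAverage_length, tailAverage_zero]

variable {g}

theorem tailAverage_add {l : ℕ} {k₀ : BitString m} (hk₀ : ∀ j : Fin m, j < l → k₀ j = 0)
    (k : BitString m) : tailAverage g l (k + k₀) = tailAverage g l k := by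
  have shift := Equiv.sum_comp (Equiv.addLeft k₀) fun k' => g (k + tail l k')
  simp only [Equiv.coe_addLeft, tail_add, tail_eq_self hk₀, ← add_assoc] at shift
  rw [tailAverage, shift, tailAverage]

theorem tailAverage_succ_add_tailAverage_succ_add_single (l : Fin m) (k : BitString m) :
    tailAverage g (l + 1) k + tailAverage g (l + 1) (k + Pi.single l 1) =
      (2 : ℂ) • tailAverage g l k := by
  have tail_single : tail (l + 1) (Pi.single l 1 : BitString m) = 0 := by
    ext j
    rcases eq_or_ne j l with rfl | hj
    · simp [tail]
    · simp [tail, hj]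
  have pair (k' : BitString m) :
      g (k + tail (l + 1) k') + g (k + Pi.single l 1 + tail (l + 1) k') =
        g (k + tail l k') + g (k + tail l (k' + Pi.single l 1)) := by
    rw [tail_eq_add_single, tail_eq_add_single l (k' + _), tail_add, tail_single, add_zero,
      Pi.add_apply, Pi.single_eq_same, add_right_comm k, ← add_assoc, ← add_assoc]
    rcases bit_eq_zero_or_one (k' l) with hbit | hbit
    · rw [hbit, zero_add, Pi.single_zero, add_zero]
    · rw [hbit, CharTwo.add_self_eq_zero, Pi.single_zero, add_zero, add_comm]
  have shift := Equiv.sum_comp (Equiv.addRight (Pi.single l 1)) fun k' => g (k + tail l k')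
  simp only [Equiv.coe_addRight] at shift
  simp only [tailAverage]
  rw [← smul_add, ← Finset.sum_add_distrib]
  simp only [pair, Finset.sum_add_distrib, shift]
  rw [two_smul, smul_add]

theorem hybridDiff_add {l : Fin m} {k₀ : BitString m} (hk₀ : ∀ j < l, k₀ j = 0)
    (k : BitString m) : hybridDiff g l (k + k₀) = bitChar (k₀ l) • hybridDiff g l k := by
  have average_succ : tailAverage g (l + 1) (k + k₀) =
      tailAverage g (l + 1) (k + Pi.single l (k₀ l)) := by
    rw [← add_sub_cancel (Pi.single l (k₀ l)) k₀, ← add_assoc]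
    refine (tailAverage_add (fun j hj => ?_) _).trans (by simp)
    rcases eq_or_ne j l with rfl | hne
    · simp
    · simp [hne, hk₀ j (lt_of_le_of_ne (Nat.lt_succ_iff.1 hj) hne)]
  rw [hybridDiff, hybridDiff, average_succ, tailAverage_add hk₀]
  rcases bit_eq_zero_or_one (k₀ l) with hbit | hbit
  · rw [hbit, Pi.single_zero, add_zero, AddChar.map_zero_eq_one, one_smul]
  · have average := tailAverage_succ_add_tailAverage_succ_add_single (g := g) l k
    rw [hbit, bitChar_one, neg_one_smul, eq_sub_of_add_eq' average, two_smul]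
    abel

end Module

section Norm

variable [NormedAddCommGroup M] [NormedSpace ℂ M] {g : BitString m → M} {C : ℝ}

theorem norm_tailAverage_le (hg : ∀ k, ‖g k‖ ≤ C) (l : ℕ) (k : BitString m) :
    ‖tailAverage g l k‖ ≤ C := by
  have norm_sum_le : ‖∑ k', g (k + tail l k')‖ ≤ 2 ^ m * C := by
    simpa [card_bitString] using
      norm_sum_le_of_le Finset.univ fun k' _ => hg (k + tail l k')
  rw [tailAverage, norm_smul, norm_div, norm_one, norm_pow, Complex.norm_ofNat,
    one_div_mul_eq_div, div_le_iff₀' (by positivity)]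
  exact norm_sum_le

theorem norm_hybridDiff_le (hg : ∀ k, ‖g k‖ ≤ C) (l : ℕ) (k : BitString m) :
    ‖hybridDiff g l k‖ ≤ 2 * C :=
  calc ‖hybridDiff g l k‖ ≤ ‖tailAverage g (l + 1) k‖ + ‖tailAverage g l k‖ := norm_sub_le _ _
    _ ≤ 2 * C := by
      rw [two_mul]
      exact add_le_add (norm_tailAverage_le hg _ _) (norm_tailAverage_le hg _ _)

end Norm

end Hybrid

/-! ### Operators that depend on the syndrome and on the key -/

namespace Params

variable (Q : Params)

theorem syndrome_apply (x : BitString Q.n) (j : Fin Q.r) :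
    Q.syndrome x j = x ⬝ᵥ Q.rows (Fin.castAdd Q.m j) := by
  rw [rows, Fin.append_left]
  rfl

theorem key_apply (x : BitString Q.n) (j : Fin Q.m) :
    Q.key x j = x ⬝ᵥ Q.rows (Fin.natAdd Q.r j) := by
  rw [rows, Fin.append_right]
  rfl

/-- The span of `v_1, …, v_{r'}` with `r' = r + l`: the parities that Eve knows when the key bit
with index `l` is compared with a uniform one. -/
def precedingSpan (l : Fin Q.m) : Submodule Bit (BitString Q.n) :=
  Submodule.span Bit (Q.rows '' {l' | l' < Fin.natAdd Q.r l})

theorem minDist_le (l : Fin Q.m) :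
    minDist Q.rows ≤ distToSubspace (Q.rows (Fin.natAdd Q.r l)) (Q.precedingSpan l) :=
  ciInf_le (OrderBot.bddBelow _) l

theorem hybridDiff_key_add {M : Type*} [AddCommGroup M] [Module ℂ M]
    (g : BitString Q.r → Q.Key → M) (l : Fin Q.m) (x x₀ : BitString Q.n)
    (hx₀ : ∀ u ∈ Q.precedingSpan l, x₀ ⬝ᵥ u = 0) :
    hybridDiff (g (Q.syndrome (x + x₀))) l (Q.key (x + x₀)) =
      bitChar (x₀ ⬝ᵥ Q.rows (Fin.natAdd Q.r l)) •
        hybridDiff (g (Q.syndrome x)) l (Q.key x) := by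
  have hrow (l' : Fin (Q.r + Q.m)) (hl' : l' < Fin.natAdd Q.r l) : x₀ ⬝ᵥ Q.rows l' = 0 :=
    hx₀ _ (Submodule.subset_span ⟨l', hl', rfl⟩)
  have hsyndrome : Q.syndrome (x + x₀) = Q.syndrome x := by
    ext j
    have hlt : Fin.castAdd Q.m j < Fin.natAdd Q.r l := j.2.trans_le (Nat.le_add_right ..)
    rw [syndrome_apply, syndrome_apply, add_dotProduct, hrow _ hlt, add_zero]
  have hkey : Q.key (x + x₀) = Q.key x + Q.key x₀ := Matrix.add_vecMul ..
  rw [hsyndrome, hkey, hybridDiff_add (fun j hj => ?_), key_apply]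
  rw [key_apply]
  exact hrow _ ((Fin.natAdd_lt_natAdd_iff _).2 hj)

end Params

/-! ### The probes in the two bases -/

theorem norm_toLp_mulVec_of_mem_unitaryGroup {α : Type*} [Fintype α] [DecidableEq α]
    {U : Matrix α α ℂ} (hU : U ∈ Matrix.unitaryGroup α ℂ) (f : α → ℂ) :
    ‖WithLp.toLp 2 (U.mulVec f)‖ = ‖WithLp.toLp 2 f‖ := by
  rw [← Matrix.toEuclideanCLM_toLp]
  exact ContinuousLinearMap.norm_map_of_mem_unitary (Unitary.map_mem _ hU) _

theorem sum_bit {M : Type*} [AddCommMonoid M] (f : Bit → M) : ∑ a, f a = f 0 + f 1 :=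
  Fin.sum_univ_two f

theorem inv_sqrt_two_mul_self : (√2 : ℂ)⁻¹ * (√2 : ℂ)⁻¹ = 2⁻¹ := by
  rw [← mul_inv, ← Complex.ofReal_mul, Real.mul_self_sqrt zero_le_two, Complex.ofReal_ofNat]

theorem ket_zero_eq (i : Bit) :
    ket 0 i = (√2 : ℂ)⁻¹ • ∑ s, bitChar (i * s) • ket 1 s := by
  have h := inv_sqrt_two_mul_self
  ext t
  rcases bit_eq_zero_or_one i with rfl | rfl <;> rcases bit_eq_zero_or_one t with rfl | rfl <;>
    simp [ket, sum_bit] <;> linear_combination (-2 : ℂ) * h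

theorem sum_norm_sq_ket (b i : Bit) : ∑ t, ‖ket b i t‖ ^ 2 = 1 := by
  rcases bit_eq_zero_or_one b with rfl | rfl <;> rcases bit_eq_zero_or_one i with rfl | rfl <;>
    simp [ket, sum_bit, ← two_mul]

theorem of_star_ket_mem_unitaryGroup (b : Bit) :
    (Matrix.of fun i t => star (ket b i t)) ∈ Matrix.unitaryGroup Bit ℂ := by
  have h := inv_sqrt_two_mul_self
  rw [Matrix.mem_unitaryGroup_iff]
  ext i i'
  rcases bit_eq_zero_or_one b with rfl | rfl <;> rcases bit_eq_zero_or_one i with rfl | rfl <;>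
    rcases bit_eq_zero_or_one i' with rfl | rfl <;>
    simp [ket, Matrix.mul_apply, sum_bit, h, ← two_mul]

theorem sum_norm_sq_star_ket_mul (b : Bit) (f : Bit → ℂ) :
    ∑ i', ‖∑ t, star (ket b i' t) * f t‖ ^ 2 = ∑ t, ‖f t‖ ^ 2 := by
  have h := norm_toLp_mulVec_of_mem_unitaryGroup (of_star_ket_mem_unitaryGroup b) f
  rw [← sq_eq_sq₀ (norm_nonneg _) (norm_nonneg _), EuclideanSpace.norm_sq_eq,
    EuclideanSpace.norm_sq_eq] at h
  exact h

namespace CollectiveAttack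

variable {N : ℕ} (A : CollectiveAttack N)

/-- The joint state of the `j`-th probe and the `j`-th qubit after Eve's unitary. -/
def evolved (j : Fin N) (b i : Bit) : Fin (A.dim j) × Bit → ℂ :=
  (A.U j : Matrix (Fin (A.dim j) × Bit) (Fin (A.dim j) × Bit) ℂ).mulVec
    (fun p => A.init j p.1 * ket b i p.2)

theorem branch_apply (j : Fin N) (b i i' : Bit) (e : Fin (A.dim j)) :
    A.branch j b i i' e = ∑ t, star (ket b i' t) * A.evolved j b i (e, t) := rfl

theorem evolved_zero (j : Fin N) (i : Bit) :
    A.evolved j 0 i = (√2 : ℂ)⁻¹ • ∑ s, bitChar (i * s) • A.evolved j 1 s := by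
  simp only [evolved, ← Matrix.mulVec_smul, ← Matrix.mulVec_sum]
  congr 1
  ext p
  rw [ket_zero_eq]
  simp only [Pi.smul_apply, Finset.sum_apply, smul_eq_mul, Finset.mul_sum]
  exact Finset.sum_congr rfl fun s _ => by ring

theorem branch_zero (j : Fin N) (i i' : Bit) (e : Fin (A.dim j)) :
    A.branch j 0 i i' e =
      2⁻¹ * ∑ s', ∑ s, bitChar (i' * s') * (bitChar (i * s) * A.branch j 1 s s' e) := by
  rw [← inv_sqrt_two_mul_self]
  simp only [branch_apply, evolved_zero, ket_zero_eq i', sum_bit, Pi.smul_apply,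
    Pi.add_apply, smul_eq_mul, star_mul', star_add, Complex.star_def, conj_bitChar, map_inv₀,
    Complex.conj_ofReal]
  ring

theorem sum_norm_sq_evolved (j : Fin N) (b i : Bit) : ∑ p, ‖A.evolved j b i p‖ ^ 2 = 1 := by
  have hinit : ∑ e, ‖A.init j e‖ ^ 2 = 1 := by
    rw [← EuclideanSpace.norm_sq_eq, A.init_unit, one_pow]
  have hnorm := EuclideanSpace.norm_sq_eq (WithLp.toLp 2 (A.evolved j b i))
  rw [evolved, norm_toLp_mulVec_of_mem_unitaryGroup (A.U j).2, EuclideanSpace.norm_sq_eq,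
    Fintype.sum_prod_type] at hnorm
  refine hnorm.symm.trans ?_
  simp only [norm_mul, mul_pow, ← Finset.mul_sum, sum_norm_sq_ket, mul_one, hinit]

theorem sum_norm_sq_branch (j : Fin N) (b i : Bit) :
    ∑ i', ∑ e, ‖A.branch j b i i' e‖ ^ 2 = 1 := by
  rw [Finset.sum_comm, ← A.sum_norm_sq_evolved j b i, Fintype.sum_prod_type]
  exact Finset.sum_congr rfl fun e _ =>
    sum_norm_sq_star_ket_mul b fun t => A.evolved j b i (e, t)

/-- The vector `probeVector` of Eve's probes, in the Hilbert space of the probes. -/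
def probeState (b i iB : BitString N) : EuclideanSpace ℂ A.Probes :=
  WithLp.toLp 2 (A.probeVector b i iB)

theorem norm_sq_probeState (b i iB : BitString N) :
    ‖A.probeState b i iB‖ ^ 2 = A.outcomeProb b i iB := by
  simp only [probeState, EuclideanSpace.norm_sq_eq, probeVector, outcomeProb, norm_prod,
    ← Finset.prod_pow]
  rw [Finset.prod_univ_sum, Fintype.piFinset_univ]

theorem outcomeProb_nonneg (b i iB : BitString N) : 0 ≤ A.outcomeProb b i iB :=
  (sq_nonneg _).trans_eq (A.norm_sq_probeState b i iB)

theorem sum_outcomeProb (b i : BitString N) : ∑ iB, A.outcomeProb b i iB = 1 := by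
  have h := Finset.prod_univ_sum (fun _ : Fin N => (Finset.univ : Finset Bit))
    (fun j i' => ∑ e, ‖A.branch j (b j) (i j) i' e‖ ^ 2)
  rw [Fintype.piFinset_univ] at h
  simp only [outcomeProb, ← h, sum_norm_sq_branch, Finset.prod_const_one]

theorem sum_sum_outcomeProb (b : BitString N) : ∑ i, ∑ iB, A.outcomeProb b i iB = 2 ^ N := by
  simp [sum_outcomeProb]

theorem outcomeProb_smul_eveState (b i iB : BitString N) :
    (A.outcomeProb b i iB : ℂ) • A.eveState b i iB =
      Matrix.vecMulVec (A.probeVector b i iB) (star (A.probeVector b i iB)) := by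
  rw [eveState, smul_smul]
  by_cases h : A.outcomeProb b i iB = 0
  · have hzero : A.probeVector b i iB = 0 := by
      rw [← norm_sq_probeState, sq_eq_zero_iff, norm_eq_zero] at h
      exact congrArg WithLp.ofLp h
    simp [hzero]
  · rw [mul_inv_cancel₀ (Complex.ofReal_ne_zero.2 h), one_smul]

end CollectiveAttack

/-! ### Partitions of the qubits -/

theorem exists_orderEmbOfFin_eq {N k : ℕ} {s : BitString N} (hs : hammingNorm s = k) {j : Fin N}
    (hj : s j ≠ 0) :
    ∃ l, Finset.orderEmbOfFin (Finset.univ.filter fun j => s j ≠ 0) hs l = j :=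
  (Set.ext_iff.1 (Finset.range_orderEmbOfFin (Finset.univ.filter fun j => s j ≠ 0) hs) j).2
    (by simpa using hj)

namespace Params

variable {Q : Params} (P : Q.Partition)

theorem partition_sum_apply (j : Fin Q.N) : P.1.1 j + P.1.2.1 j + P.1.2.2 j = 1 := by
  have hcard : hammingNorm _ = (Finset.univ : Finset (Fin Q.N)).card :=
    P.2.2.2.2.trans (Finset.card_fin _).symm
  exact Fin.eq_one_of_ne_zero _ (Finset.card_filter_eq_iff.1 hcard j (Finset.mem_univ j))

/-- The position in the whole string of each INFO, TEST-Z and TEST-X bit. -/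
def position : Fin Q.n ⊕ (Fin Q.nz ⊕ Fin Q.nx) → Fin Q.N :=
  Sum.elim (Finset.orderEmbOfFin (Finset.univ.filter fun j => P.1.1 j ≠ 0) P.2.1)
    (Sum.elim (Finset.orderEmbOfFin (Finset.univ.filter fun j => P.1.2.1 j ≠ 0) P.2.2.1)
      (Finset.orderEmbOfFin (Finset.univ.filter fun j => P.1.2.2 j ≠ 0) P.2.2.2.1))

theorem position_bijective : Function.Bijective (position P) := by
  rw [Fintype.bijective_iff_surjective_and_card]
  refine ⟨fun j => ?_, by simp [add_assoc]⟩
  have hsum := partition_sum_apply P j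
  by_cases hs : P.1.1 j ≠ 0
  · obtain ⟨l, hl⟩ := exists_orderEmbOfFin_eq P.2.1 hs
    exact ⟨Sum.inl l, hl⟩
  by_cases hz : P.1.2.1 j ≠ 0
  · obtain ⟨l, hl⟩ := exists_orderEmbOfFin_eq P.2.2.1 hz
    exact ⟨Sum.inr (Sum.inl l), hl⟩
  rw [not_not.1 hs, not_not.1 hz, zero_add, zero_add] at hsum
  obtain ⟨l, hl⟩ := exists_orderEmbOfFin_eq P.2.2.2.1 (hsum ▸ one_ne_zero)
  exact ⟨Sum.inr (Sum.inr l), hl⟩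

/-- The bijection `position`, as an equivalence. -/
def positionEquiv : Fin Q.n ⊕ (Fin Q.nz ⊕ Fin Q.nx) ≃ Fin Q.N :=
  Equiv.ofBijective (position P) (position_bijective P)

theorem prod_position {M : Type*} [CommMonoid M] (f : Fin Q.N → M) :
    ∏ j, f j = (∏ l, f (position P (Sum.inl l))) * ∏ l, f (position P (Sum.inr l)) := by
  rw [← Equiv.prod_comp (positionEquiv P), Fintype.prod_sum_type]
  rfl

theorem infoMask_position_inr (l : Fin Q.nz ⊕ Fin Q.nx) : P.1.1 (position P (Sum.inr l)) = 0 := by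
  by_contra h
  obtain ⟨l', hl'⟩ := exists_orderEmbOfFin_eq P.2.1 h
  exact Sum.inl_ne_inr ((position_bijective P).1 (a₁ := Sum.inl l') hl')

theorem testZMask_position_inl (l : Fin Q.n) : P.1.2.1 (position P (Sum.inl l)) = 0 := by
  by_contra h
  obtain ⟨l', hl'⟩ := exists_orderEmbOfFin_eq P.2.2.1 h
  exact Sum.inr_ne_inl ((position_bijective P).1 (a₁ := Sum.inr (Sum.inl l')) hl')

theorem bases_position_inl (l : Fin Q.n) : bases P (position P (Sum.inl l)) = 0 := by
  by_contra h
  obtain ⟨l', hl'⟩ := exists_orderEmbOfFin_eq P.2.2.2.1 h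
  exact Sum.inr_ne_inl ((position_bijective P).1 (a₁ := Sum.inr (Sum.inr l')) hl')

/-- The bases of the virtual protocol in which the INFO bits are sent in the `x` basis. They
depend on the TEST-Z positions only. -/
def conjugateBases : BitString Q.N := 1 + P.1.2.1

theorem conjugateBases_position_inl (l : Fin Q.n) :
    conjugateBases P (position P (Sum.inl l)) = 1 := by
  rw [conjugateBases, Pi.add_apply, testZMask_position_inl, Pi.one_apply, add_zero]

theorem conjugateBases_position_inr (l : Fin Q.nz ⊕ Fin Q.nx) :
    conjugateBases P (position P (Sum.inr l)) = bases P (position P (Sum.inr l)) := by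
  have hsum := partition_sum_apply P (position P (Sum.inr l))
  rw [infoMask_position_inr, zero_add] at hsum
  rw [conjugateBases, Pi.add_apply, Pi.one_apply, ← hsum, bases, add_right_comm,
    CharTwo.add_self_eq_zero, zero_add]

/-- The string with given INFO bits and given TEST-Z and TEST-X bits. -/
def combine : BitString Q.n × (BitString Q.nz × BitString Q.nx) ≃ BitString Q.N :=
  ((Equiv.prodCongr (Equiv.refl _) (Equiv.sumArrowEquivProdArrow _ _ _).symm).trans
    (Equiv.sumArrowEquivProdArrow _ _ _).symm).trans
      (Equiv.arrowCongr (positionEquiv P) (Equiv.refl Bit))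

variable {P} (x : BitString Q.n) (τ : BitString Q.nz × BitString Q.nx)

theorem combine_position (l : Fin Q.n ⊕ (Fin Q.nz ⊕ Fin Q.nx)) :
    combine P (x, τ) (position P l) = Sum.elim x (Sum.elim τ.1 τ.2) l :=
  congrArg (Sum.elim x (Sum.elim τ.1 τ.2)) ((positionEquiv P).symm_apply_apply l)

@[simp] theorem info_combine : info P (combine P (x, τ)) = x :=
  funext fun l => combine_position x τ (Sum.inl l)

@[simp] theorem testZ_combine : testZ P (combine P (x, τ)) = τ.1 :=
  funext fun l => combine_position x τ (Sum.inr (Sum.inl l))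

@[simp] theorem testX_combine : testX P (combine P (x, τ)) = τ.2 :=
  funext fun l => combine_position x τ (Sum.inr (Sum.inr l))

/-- A `z` basis state is the Fourier transform of the `x` basis states; on the INFO bits this
applies both to the bits that Alice sends and to the outcomes that Bob measures. -/
theorem probeState_bases_eq (A : CollectiveAttack Q.N) (τB : BitString Q.nz × BitString Q.nx)
    (xB : BitString Q.n) :
    A.probeState (bases P) (combine P (x, τ)) (combine P (xB, τB)) =
      ((2 : ℂ) ^ Q.n)⁻¹ • walshHadamard (fun s' => walshHadamard (fun s =>
        A.probeState (conjugateBases P) (combine P (s, τ)) (combine P (s', τB))) x) xB := by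
  ext e
  let infoFactor (l : Fin Q.n) (a a' : Bit) : ℂ :=
    A.branch (position P (Sum.inl l)) 1 a a' (e (position P (Sum.inl l)))
  let testFactor : ℂ := ∏ l, A.branch (position P (Sum.inr l)) (bases P (position P (Sum.inr l)))
    (Sum.elim τ.1 τ.2 l) (Sum.elim τB.1 τB.2 l) (e (position P (Sum.inr l)))
  have conjugate_apply (s s' : BitString Q.n) :
      A.probeState (conjugateBases P) (combine P (s, τ)) (combine P (s', τB)) e =
        testFactor * ∏ l, infoFactor l (s l) (s' l) := by
    rw [mul_comm]
    refine (prod_position P _).trans ?_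
    simp only [combine_position, Sum.elim_inl, Sum.elim_inr, conjugateBases_position_inl,
      conjugateBases_position_inr, testFactor, infoFactor]
  have bases_apply :
      A.probeState (bases P) (combine P (x, τ)) (combine P (xB, τB)) e =
        ((2 : ℂ) ^ Q.n)⁻¹ * (testFactor * ∏ l, ∑ a', bitChar (xB l * a') *
          ∑ a, bitChar (x l * a) * infoFactor l a a') := by
    rw [mul_comm testFactor, ← mul_assoc]
    refine (prod_position P _).trans ?_
    simp only [combine_position, Sum.elim_inl, Sum.elim_inr, bases_position_inl,
      CollectiveAttack.branch_zero, ← Finset.mul_sum, Finset.prod_mul_distrib, Finset.prod_const,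
      Finset.card_univ, Fintype.card_fin, inv_pow, testFactor, infoFactor]
  rw [PiLp.smul_apply, smul_eq_mul, bases_apply]
  simp only [walshHadamard_apply, conjugate_apply]
  simp only [fun s' : BitString Q.n => walshHadamard_mul_prod testFactor fun l a =>
    infoFactor l a (s' l)]
  rw [walshHadamard_mul_prod testFactor fun l a' => ∑ a, bitChar (x l * a) * infoFactor l a a']

end Params

/-! ### The random partition -/

theorem hammingNorm_substring {N k : ℕ} (s : BitString N) (hs : hammingNorm s = k)
    (c : BitString N) : hammingNorm (substring s hs c) =
      (Finset.univ.filter fun j => s j ≠ 0 ∧ c j ≠ 0).card := by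
  rw [hammingNorm, ← Finset.card_map
    (Finset.orderEmbOfFin (Finset.univ.filter fun j => s j ≠ 0) hs).toEmbedding]
  congr 1
  ext j
  simp only [Finset.mem_map, Finset.mem_filter, Finset.mem_univ, true_and]
  constructor
  · rintro ⟨l, hl, rfl⟩
    exact ⟨(Finset.mem_filter.1 (Finset.orderEmbOfFin_mem _ hs l)).2, hl⟩
  · rintro ⟨hsj, hcj⟩
    obtain ⟨l, rfl⟩ := exists_orderEmbOfFin_eq hs hsj
    exact ⟨l, hcj, rfl⟩

theorem card_filter_eq_zero_add_hammingNorm {N : ℕ} (z : BitString N) :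
    (Finset.univ.filter fun j => z j = 0).card + hammingNorm z = N :=
  (Finset.card_filter_add_card_filter_not _).trans (Finset.card_fin N)

namespace Params

variable {Q : Params}

/-- The INFO positions. -/
def infoSet (P : Q.Partition) : Finset (Fin Q.N) := Finset.univ.filter fun j => P.1.1 j ≠ 0

/-- The positions in which `z` is zero. If `z` marks the TEST-Z positions, these are the INFO and
the TEST-X positions. -/
def nonZ (z : BitString Q.N) : Finset (Fin Q.N) := Finset.univ.filter fun j => z j = 0

theorem mem_infoSet {P : Q.Partition} {j : Fin Q.N} : j ∈ infoSet P ↔ P.1.1 j ≠ 0 :=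
  Finset.mem_filter_univ j

theorem mem_nonZ {z : BitString Q.N} {j : Fin Q.N} : j ∈ nonZ z ↔ z j = 0 :=
  Finset.mem_filter_univ j

theorem card_nonZ {z : BitString Q.N} (hz : hammingNorm z = Q.nz) :
    (nonZ z).card = Q.n + Q.nx := by
  have hcard : (nonZ z).card + hammingNorm z = Q.n + Q.nz + Q.nx :=
    card_filter_eq_zero_add_hammingNorm z
  omega

theorem infoSet_subset_nonZ (P : Q.Partition) : infoSet P ⊆ nonZ P.1.2.1 := fun j hj => by
  obtain ⟨l, rfl⟩ := exists_orderEmbOfFin_eq P.2.1 (mem_infoSet.1 hj)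
  exact mem_nonZ.2 (testZMask_position_inl P l)

theorem bases_ne_zero_iff (P : Q.Partition) (j : Fin Q.N) :
    bases P j ≠ 0 ↔ j ∈ nonZ P.1.2.1 \ infoSet P := by
  have one_add_ne_zero_iff : ∀ a : Bit, 1 + a ≠ 0 ↔ a = 0 := by decide
  rw [Finset.mem_sdiff, mem_infoSet, mem_nonZ]
  obtain ⟨l | l, rfl⟩ := (position_bijective P).2 j
  · have hinfo := partition_sum_apply P (position P (Sum.inl l))
    have hbases := bases_position_inl P l
    rw [bases] at hbases
    rw [testZMask_position_inl, hbases, add_zero, add_zero] at hinfo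
    simp [bases, hbases, hinfo]
  · rw [← conjugateBases_position_inr, conjugateBases, Pi.add_apply, Pi.one_apply,
      one_add_ne_zero_iff, infoMask_position_inr]
    simp

theorem hammingNorm_info (P : Q.Partition) (c : BitString Q.N) : hammingNorm (info P c) =
    (infoSet P ∩ (nonZ P.1.2.1).filter fun j => c j ≠ 0).card := by
  rw [info, hammingNorm_substring]
  congr 1
  ext j
  rw [Finset.mem_filter_univ, Finset.mem_inter, Finset.mem_filter, mem_infoSet]
  exact ⟨fun h => ⟨h.1, infoSet_subset_nonZ P (mem_infoSet.2 h.1), h.2⟩, fun h => ⟨h.1, h.2.2⟩⟩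

theorem hammingNorm_testX_add_hammingNorm_info (P : Q.Partition) (c : BitString Q.N) :
    hammingNorm (testX P c) + hammingNorm (info P c) =
      ((nonZ P.1.2.1).filter fun j => c j ≠ 0).card := by
  rw [hammingNorm_info, testX, hammingNorm_substring,
    ← Finset.card_sdiff_add_card_inter ((nonZ P.1.2.1).filter fun j => c j ≠ 0) (infoSet P),
    Finset.inter_comm]
  congr 2
  ext j
  rw [Finset.mem_filter_univ, Finset.mem_sdiff, Finset.mem_filter, and_right_comm,
    ← Finset.mem_sdiff, ← bases_ne_zero_iff, bases]

theorem injOn_infoSet (z : BitString Q.N) :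
    Set.InjOn infoSet {P : Q.Partition | P.1.2.1 = z} := by
  have bit_eq_of_ne_zero_iff : ∀ {a a' : Bit}, (a ≠ 0 ↔ a' ≠ 0) → a = a' := by decide
  intro P (hz : P.1.2.1 = z) P' (hz' : P'.1.2.1 = z) hset
  have hinfo : P.1.1 = P'.1.1 := funext fun j => bit_eq_of_ne_zero_iff <| by
    rw [← mem_infoSet, ← mem_infoSet, hset]
  have hbases : P.1.2.2 = P'.1.2.2 := funext fun j => by
    have hsum := (partition_sum_apply P j).trans (partition_sum_apply P' j).symm
    rwa [hinfo, hz, hz', add_left_cancel_iff] at hsum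
  exact Subtype.ext (Prod.ext hinfo (Prod.ext (hz.trans hz'.symm) hbases))

theorem exists_infoSet_eq {z : BitString Q.N} (hz : hammingNorm z = Q.nz)
    {S : Finset (Fin Q.N)} (hS : S ∈ (nonZ z).powersetCard Q.n) :
    ∃ P : Q.Partition, P.1.2.1 = z ∧ infoSet P = S := by
  obtain ⟨hsubset, hcard⟩ := Finset.mem_powersetCard.1 hS
  let s : BitString Q.N := fun j => if j ∈ S then 1 else 0
  have hs : (Finset.univ.filter fun j => s j ≠ 0) = S := by
    ext j
    simp [s]
  have hb : (Finset.univ.filter fun j => (1 + s + z) j ≠ 0) = nonZ z \ S := by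
    ext j
    by_cases hj : j ∈ S
    · simp [s, hj, mem_nonZ.1 (hsubset hj), CharTwo.add_self_eq_zero]
    · rcases bit_eq_zero_or_one (z j) with hzj | hzj <;>
        simp [s, hj, mem_nonZ, hzj, CharTwo.add_self_eq_zero]
  have hsum : s + z + (1 + s + z) = 1 := by
    rw [add_assoc 1, add_left_comm, ZModModule.add_self, add_zero]
  refine ⟨⟨(s, z, 1 + s + z), ?_, hz, ?_, ?_⟩, rfl, hs⟩
  · rw [hammingNorm, hs, hcard]
  · rw [hammingNorm, hb, Finset.card_sdiff_of_subset hsubset, hcard, card_nonZ hz,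
      Nat.add_sub_cancel_left]
  · rw [hsum, hammingNorm]
    simp

/-- The error string `c` passes the test on the TEST-X bits, although it has so many errors on the
INFO bits that it may connect two strings of distinct parities. -/
def Undetected (P : Q.Partition) (c : BitString Q.N) : Prop :=
  (hammingNorm (testX P c) : ℝ) / Q.nx ≤ Q.pax ∧ minDist Q.rows ≤ 2 * hammingNorm (info P c)

section Sampling

variable {ε : ℝ} (hn : 0 < Q.n) (hnx : 0 < Q.nx)
  (hd : Q.pax + ε ≤ (minDist Q.rows : ℝ) / Q.n / 2)
include hn hnx hd

theorem mul_add_le_card_infoSet_inter {P : Q.Partition} {c : BitString Q.N}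
    (hc : Undetected P c) :
    (Q.n : ℝ) * (((nonZ P.1.2.1).filter fun j => c j ≠ 0).card / (nonZ P.1.2.1).card +
      ε * (Q.nx / (Q.n + Q.nx))) ≤
      (infoSet P ∩ (nonZ P.1.2.1).filter fun j => c j ≠ 0).card := by
  rw [← hammingNorm_testX_add_hammingNorm_info, ← hammingNorm_info, card_nonZ P.2.2.1]
  obtain ⟨htest, hmin⟩ := hc
  have hn' : (0 : ℝ) < Q.n := Nat.cast_pos.2 hn
  have hnx' : (0 : ℝ) < Q.nx := Nat.cast_pos.2 hnx
  have hmin' : (minDist Q.rows : ℝ) ≤ 2 * hammingNorm (info P c) := by exact_mod_cast hmin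
  have hinfo : Q.n * (Q.pax + ε) ≤ hammingNorm (info P c) := by
    rw [div_div, le_div_iff₀ (by positivity)] at hd
    linarith
  have htest' : (hammingNorm (testX P c) : ℝ) ≤ Q.nx * Q.pax := (div_le_iff₀' hnx').1 htest
  push_cast
  rw [← mul_div_assoc, ← add_div, ← mul_div_assoc, div_le_iff₀ (by positivity)]
  linear_combination (Q.n : ℝ) * htest' + (Q.nx : ℝ) * hinfo

open Classical in
theorem card_undetected_le (hε : 0 ≤ ε) (z c : BitString Q.N) :
    ((Finset.univ.filter fun P : Q.Partition => P.1.2.1 = z ∧ Undetected P c).card : ℝ) ≤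
      Real.exp (-2 * Q.n * (ε * (Q.nx / (Q.n + Q.nx))) ^ 2) *
        (Finset.univ.filter fun P : Q.Partition => P.1.2.1 = z).card := by
  by_cases hz : hammingNorm z = Q.nz
  swap
  · have hempty : (Finset.univ.filter fun P : Q.Partition => P.1.2.1 = z ∧ Undetected P c) = ∅ :=
      Finset.filter_eq_empty_iff.2 fun P _ hP => hz (hP.1 ▸ P.2.2.1)
    rw [hempty, Finset.card_empty, Nat.cast_zero]
    positivity
  let C := (nonZ z).filter fun j => c j ≠ 0
  have hcard : (nonZ z).card.choose Q.n ≤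
      (Finset.univ.filter fun P : Q.Partition => P.1.2.1 = z).card := by
    rw [← Finset.card_powersetCard]
    refine Finset.card_le_card_of_surjOn infoSet fun S hS => ?_
    obtain ⟨P, hPz, hPS⟩ := exists_infoSet_eq hz hS
    exact ⟨P, by simpa using hPz, hPS⟩
  have hle : (Finset.univ.filter fun P : Q.Partition => P.1.2.1 = z ∧ Undetected P c).card ≤
      (((nonZ z).powersetCard Q.n).filter fun S => (Q.n : ℝ) *
        (C.card / (nonZ z).card + ε * (Q.nx / (Q.n + Q.nx))) ≤ (S ∩ C).card).card := by
    refine Finset.card_le_card_of_injOn infoSet (fun P hP => ?_) fun P hP P' hP' => ?_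
    · obtain ⟨rfl, hPc⟩ := (Finset.mem_filter_univ P).1 hP
      exact Finset.mem_filter.2 ⟨Finset.mem_powersetCard.2 ⟨infoSet_subset_nonZ P, P.2.1⟩,
        mul_add_le_card_infoSet_inter hn hnx hd hPc⟩
    · exact injOn_infoSet z ((Finset.mem_filter_univ P).1 hP).1
        ((Finset.mem_filter_univ P').1 hP').1
  calc _ ≤ _ := Nat.cast_le.2 hle
    _ ≤ _ := card_filter_add_le_card_inter_le (Finset.filter_subset _ _) (by positivity)
    _ ≤ _ := by
      rw [mul_comm]
      gcongr

open Classical in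
theorem sum_undetected_le (hε : 0 ≤ ε) {w : BitString Q.N → ℝ} (hw : ∀ z, 0 ≤ w z)
    (c : BitString Q.N) :
    ∑ P : Q.Partition with Undetected P c, w P.1.2.1 ≤
      Real.exp (-2 * Q.n * (ε * (Q.nx / (Q.n + Q.nx))) ^ 2) * ∑ P : Q.Partition, w P.1.2.1 := by
  have fiberwise (p : Q.Partition → Prop) : ∑ P : Q.Partition with p P, w P.1.2.1 =
      ∑ z, (Finset.univ.filter fun P : Q.Partition => P.1.2.1 = z ∧ p P).card * w z := by
    rw [← Finset.sum_fiberwise _ fun P : Q.Partition => P.1.2.1]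
    refine Finset.sum_congr rfl fun z _ => ?_
    rw [Finset.filter_filter, ← nsmul_eq_mul, ← Finset.sum_const]
    simp only [and_comm (b := _ = z)]
    exact Finset.sum_congr rfl fun P hP => by rw [((Finset.mem_filter_univ P).1 hP).1]
  have total := fiberwise fun _ => True
  simp only [Finset.filter_true, and_true] at total
  rw [total, fiberwise, Finset.mul_sum]
  refine Finset.sum_le_sum fun z _ => ?_
  rw [← mul_assoc]
  exact mul_le_mul_of_nonneg_right (card_undetected_le hn hnx hd hε z c) (hw z)

open Classical in
theorem sum_undetected_outcomeProb_le (hε : 0 ≤ ε) (A : CollectiveAttack Q.N) :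
    ∑ P : Q.Partition, ∑ i, ∑ iB with Undetected P (i + iB),
        A.outcomeProb (conjugateBases P) i iB ≤
      Real.exp (-2 * Q.n * (ε * (Q.nx / (Q.n + Q.nx))) ^ 2) *
        (Fintype.card Q.Partition * 2 ^ Q.N) := by
  have exchange (f : Q.Partition → BitString Q.N → BitString Q.N → ℝ) :
      ∑ P, ∑ i, ∑ iB, f P i iB = ∑ i, ∑ iB, ∑ P, f P i iB := by
    rw [Finset.sum_comm]
    exact Finset.sum_congr rfl fun i _ => Finset.sum_comm
  have total : ∑ i, ∑ iB, ∑ P : Q.Partition, A.outcomeProb (conjugateBases P) i iB =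
      Fintype.card Q.Partition * 2 ^ Q.N := by
    rw [← exchange]
    simp [A.sum_sum_outcomeProb]
  simp only [Finset.sum_filter]
  rw [← total, exchange, Finset.mul_sum]
  refine Finset.sum_le_sum fun i _ => ?_
  rw [Finset.mul_sum]
  refine Finset.sum_le_sum fun iB _ => ?_
  rw [← Finset.sum_filter]
  exact sum_undetected_le hn hnx hd hε (w := fun z => A.outcomeProb (1 + z) i iB)
    (fun z => A.outcomeProb_nonneg _ _ _) (i + iB)

end Sampling

end Params

/-! ### Operators on tensor products -/

section Tensor

variable {α β : Type*} {X : Matrix α α ℂ} {Y : Matrix β β ℂ}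

theorem kronecker_sum {ι : Type*} (s : Finset ι) (X : Matrix α α ℂ) (Y : ι → Matrix β β ℂ) :
    X ⊗ₖ (∑ i ∈ s, Y i) = ∑ i ∈ s, X ⊗ₖ Y i :=
  map_sum (Matrix.kroneckerBilinear (R := ℂ) X) Y s

theorem sum_kronecker {ι : Type*} (s : Finset ι) (X : ι → Matrix α α ℂ) (Y : Matrix β β ℂ) :
    (∑ i ∈ s, X i) ⊗ₖ Y = ∑ i ∈ s, X i ⊗ₖ Y :=
  map_sum ((Matrix.kroneckerBilinear (R := ℂ)).flip Y) X s

theorem sub_kronecker (X X' : Matrix α α ℂ) (Y : Matrix β β ℂ) :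
    (X - X') ⊗ₖ Y = X ⊗ₖ Y - X' ⊗ₖ Y :=
  map_sub ((Matrix.kroneckerBilinear (R := ℂ)).flip Y) X X'

theorem traceFst_sum [Fintype α] {ι : Type*} (s : Finset ι) (X : ι → Matrix (α × β) (α × β) ℂ) :
    traceFst (∑ i ∈ s, X i) = ∑ i ∈ s, traceFst (X i) := by
  ext a b
  simp only [traceFst, Matrix.of_apply, Matrix.sum_apply]
  exact Finset.sum_comm

theorem traceFst_smul [Fintype α] (c : ℂ) (X : Matrix (α × β) (α × β) ℂ) :
    traceFst (c • X) = c • traceFst X := by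
  ext a b
  simp [traceFst, Finset.mul_sum]

theorem traceFst_kronecker [Fintype α] (X : Matrix α α ℂ) (Y : Matrix β β ℂ) :
    traceFst (X ⊗ₖ Y) = X.trace • Y := by
  ext a b
  simp [traceFst, Matrix.trace, Finset.sum_mul]

theorem trace_proj [Fintype α] (a : α) : (proj a).trace = 1 := by
  classical exact Matrix.trace_single_eq_same a 1

theorem isHermitian_proj (a : α) : (proj a).IsHermitian := by
  classical rw [Matrix.IsHermitian, proj, Matrix.conjTranspose_single, star_one]

theorem isHermitian_kronecker (hX : X.IsHermitian) (hY : Y.IsHermitian) :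
    (X ⊗ₖ Y).IsHermitian := by
  rw [Matrix.IsHermitian, Matrix.conjTranspose_kronecker, hX, hY]

theorem isHermitian_sum {ι : Type*} (s : Finset ι) {X : ι → Matrix α α ℂ}
    (hX : ∀ i, (X i).IsHermitian) : (∑ i ∈ s, X i).IsHermitian := by
  rw [Matrix.IsHermitian, Matrix.conjTranspose_sum]
  exact Finset.sum_congr rfl fun i _ => hX i

variable {κ ι π : Type*}

/-- The block of an operator on a tensor product that belongs to the value `k` of the first and
the value `p` of the last register. -/
def block (W : Matrix (κ × (ι × π)) (κ × (ι × π)) ℂ) (k : κ) (p : π) : Matrix ι ι ℂ :=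
  W.submatrix (fun e => (k, (e, p))) (fun e => (k, (e, p)))

theorem trace_proj_kronecker_mul [Fintype κ] [Fintype ι] [Fintype π] (k : κ) (p : π)
    (X : Matrix ι ι ℂ) (W : Matrix (κ × (ι × π)) (κ × (ι × π)) ℂ) :
    ((proj k ⊗ₖ (X ⊗ₖ proj p)) * W).trace = (X * block W k p).trace := by
  classical
  simp [Matrix.trace, Matrix.mul_apply, Fintype.sum_prod_type, proj, block, Matrix.single_apply,
    ite_and, Finset.sum_ite_irrel]

open scoped Matrix.Norms.L2Operator in
theorem norm_block_le [Fintype κ] [Fintype ι] [Fintype π] [DecidableEq ι]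
    [DecidableEq (κ × (ι × π))] (W : Matrix (κ × (ι × π)) (κ × (ι × π)) ℂ) (k : κ) (p : π) :
    ‖block W k p‖ ≤ ‖W‖ := by
  have hinj : (fun e : ι => (k, (e, p))).Injective := fun _ _ h =>
    congrArg (fun a => a.2.1) h
  exact l2_opNorm_submatrix_le W hinj hinj

theorem proj_kronecker_proj (a : α) (b : β) : proj a ⊗ₖ proj b = proj (a, b) := by
  classical
  ext ⟨a₁, b₁⟩ ⟨a₂, b₂⟩
  simp only [Matrix.kroneckerMap_apply, proj, Matrix.single_apply, Prod.mk.injEq]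
  grind

end Tensor

/-! ### The final states -/

section FinalStates

open Params

variable {Q : Params} (A : CollectiveAttack Q.N)

/-- The probability of each pair of a partition and of a string of Alice. -/
def choiceProb (Q : Params) : ℝ := 1 / (Fintype.card Q.Partition : ℝ) * (1 / 2 ^ Q.N)

/-- The state of Eve's system if Alice sends `i`, Bob measures `iB` and the partition is `P`,
scaled by the conditional probability of `iB`. -/
def eveEventState (P : Q.Partition) (i iB : BitString Q.N) :
    Matrix (A.Probes × Q.Public) (A.Probes × Q.Public) ℂ :=
  Matrix.vecMulVec (A.probeVector (bases P) i iB) (star (A.probeVector (bases P) i iB)) ⊗ₖ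
    proj (published P i iB)

open scoped ComplexOrder in
theorem isHermitian_eveEventState (P : Q.Partition) (i iB : BitString Q.N) :
    (eveEventState A P i iB).IsHermitian :=
  isHermitian_kronecker (Matrix.posSemidef_vecMulVec_self_star _).isHermitian (isHermitian_proj _)

theorem jointProb_smul_kronecker (P : Q.Partition) (i iB : BitString Q.N) :
    (jointProb A i iB P : ℂ) • (A.eveState (bases P) i iB ⊗ₖ proj (published P i iB)) =
      (choiceProb Q : ℂ) • eveEventState A P i iB := by
  rw [eveEventState, ← A.outcomeProb_smul_eveState, Matrix.smul_kronecker, smul_smul,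
    ← Complex.ofReal_mul]
  rfl

open Classical in
theorem finalStateWith_eq (kB : Q.Partition → BitString Q.N → BitString Q.N → Q.Key) :
    finalStateWith A kB = (choiceProb Q : ℂ) • ∑ P, ∑ i, ∑ iB with TestPassed P i iB,
      proj (aliceKey P i, kB P i iB) ⊗ₖ eveEventState A P i iB := by
  have partition_first : finalStateWith A kB = ∑ P, ∑ i, ∑ iB with TestPassed P i iB,
      proj (aliceKey P i, kB P i iB) ⊗ₖ ((jointProb A i iB P : ℂ) •
        (A.eveState (bases P) i iB ⊗ₖ proj (published P i iB))) := by
    simp only [finalStateWith, Finset.sum_filter, Matrix.kronecker_smul, proj_kronecker_proj]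
    rw [Finset.sum_comm (s := (Finset.univ : Finset Q.Partition))]
    exact Finset.sum_congr rfl fun i _ => Finset.sum_comm
  simp only [partition_first, jointProb_smul_kronecker, Matrix.kronecker_smul, Finset.smul_sum]

open Classical in
theorem rhoE_eq : rhoE A = (choiceProb Q : ℂ) •
    ∑ P, ∑ i, ∑ iB with TestPassed P i iB, eveEventState A P i iB := by
  simp only [rhoE, rhoABE, finalStateWith_eq, traceFst_smul, traceFst_sum, traceFst_kronecker,
    trace_proj, one_smul]

open Classical in
theorem rhoABEprime_sub_rhoU_kronecker_rhoE :
    rhoABEprime A - rhoU Q ⊗ₖ rhoE A = (choiceProb Q : ℂ) •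
      ∑ P, ∑ i, ∑ iB with TestPassed P i iB,
        (proj (aliceKey P i, aliceKey P i) - rhoU Q) ⊗ₖ eveEventState A P i iB := by
  simp only [sub_kronecker, Finset.sum_sub_distrib, smul_sub, rhoABEprime, finalStateWith_eq,
    rhoE_eq, Matrix.kronecker_smul, kronecker_sum]

theorem isHermitian_rhoABEprime_sub_rhoU_kronecker_rhoE :
    (rhoABEprime A - rhoU Q ⊗ₖ rhoE A).IsHermitian := by
  have hU : (rhoU Q).IsHermitian := (isHermitian_sum _ fun k => isHermitian_kronecker
    (isHermitian_proj k) (isHermitian_proj k)).smul (by simp [IsSelfAdjoint])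
  rw [rhoABEprime_sub_rhoU_kronecker_rhoE]
  exact (isHermitian_sum _ fun P => isHermitian_sum _ fun i => isHermitian_sum _ fun iB =>
    isHermitian_kronecker ((isHermitian_proj _).sub hU) (isHermitian_eveEventState A P i iB)).smul
      (Complex.conj_ofReal _)

variable {A}

/-- The operator to which `W` restricts on Eve's probes if both keys are `k` and the published
information is `p`. -/
def keyOperator (W : Matrix (ABE A) (ABE A) ℂ) (p : Q.Public) (k : Q.Key) :
    EuclideanSpace ℂ A.Probes →L[ℂ] EuclideanSpace ℂ A.Probes :=
  Matrix.toEuclideanCLM (𝕜 := ℂ) (block W (k, k) p)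

open Classical in
open scoped Matrix.Norms.L2Operator in
theorem norm_keyOperator_le (W : Matrix (ABE A) (ABE A) ℂ) (p : Q.Public) (k : Q.Key) :
    ‖keyOperator W p k‖ ≤ ‖W‖ :=
  norm_block_le W (k, k) p

theorem trace_proj_kronecker_eveEventState_mul (W : Matrix (ABE A) (ABE A) ℂ) (P : Q.Partition)
    (i iB : BitString Q.N) (k : Q.Key) :
    ((proj (k, k) ⊗ₖ eveEventState A P i iB) * W).trace =
      inner ℂ (A.probeState (bases P) i iB)
        (keyOperator W (published P i iB) k (A.probeState (bases P) i iB)) := by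
  rw [eveEventState, trace_proj_kronecker_mul, trace_vecMulVec_star_mul]
  rfl

theorem trace_proj_sub_rhoU_kronecker_mul (W : Matrix (ABE A) (ABE A) ℂ) (P : Q.Partition)
    (i iB : BitString Q.N) (k : Q.Key) :
    (((proj (k, k) - rhoU Q) ⊗ₖ eveEventState A P i iB) * W).trace =
      ∑ l : Fin Q.m, inner ℂ (A.probeState (bases P) i iB)
        (hybridDiff (keyOperator W (published P i iB)) l k (A.probeState (bases P) i iB)) := by
  have rhoU_kronecker (Y : Matrix (A.Probes × Q.Public) (A.Probes × Q.Public) ℂ) :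
      rhoU Q ⊗ₖ Y = (1 / 2 ^ Q.m : ℂ) • ∑ k : Q.Key, proj (k, k) ⊗ₖ Y := by
    simp only [rhoU, proj_kronecker_proj, Matrix.smul_kronecker, sum_kronecker]
  rw [← inner_sum, ← sum_apply, sum_hybridDiff, sub_kronecker,
    rhoU_kronecker, Matrix.sub_mul, Matrix.trace_sub, Matrix.smul_mul, Matrix.trace_smul,
    Finset.sum_mul, Matrix.trace_sum]
  simp only [trace_proj_kronecker_eveEventState_mul, sub_apply, smul_apply, inner_sub_right,
    inner_smul_right, sum_apply, inner_sum, smul_eq_mul]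

open Classical in
theorem trace_difference_mul (W : Matrix (ABE A) (ABE A) ℂ) :
    ((rhoABEprime A - rhoU Q ⊗ₖ rhoE A) * W).trace =
      choiceProb Q * ∑ P : Q.Partition, ∑ l : Fin Q.m, ∑ i, ∑ iB with TestPassed P i iB,
        inner ℂ (A.probeState (bases P) i iB) (hybridDiff (keyOperator W (published P i iB)) l
          (aliceKey P i) (A.probeState (bases P) i iB)) := by
  simp only [rhoABEprime_sub_rhoU_kronecker_rhoE, Matrix.smul_mul, Finset.sum_mul,
    Matrix.trace_smul, Matrix.trace_sum, trace_proj_sub_rhoU_kronecker_mul, smul_eq_mul]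
  congr 1
  refine Finset.sum_congr rfl fun P _ => ?_
  rw [Finset.sum_comm (s := (Finset.univ : Finset (Fin Q.m)))]
  exact Finset.sum_congr rfl fun i _ => Finset.sum_comm

end FinalStates

/-! ### The distance of the final state from the ideal state -/

namespace Params

variable {Q : Params}

theorem sum_combine {M : Type*} [AddCommMonoid M] (P : Q.Partition)
    (f : BitString Q.N → BitString Q.N → M) :
    ∑ i, ∑ iB, f i iB = ∑ t : (BitString Q.nz × BitString Q.nx) × (BitString Q.nz × BitString Q.nx),
      ∑ x, ∑ xB, f (combine P (x, t.1)) (combine P (xB, t.2)) := by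
  have sum_string (g : BitString Q.N → M) : ∑ i, g i = ∑ τ, ∑ x, g (combine P (x, τ)) := by
    rw [← Equiv.sum_comp (combine P), Fintype.sum_prod_type_right]
  rw [sum_string fun i => ∑ iB, f i iB]
  refine Eq.trans (Finset.sum_congr rfl fun τ _ => ?_) (Fintype.sum_prod_type _).symm
  simp only [fun i => sum_string (f i)]
  exact Finset.sum_comm

variable {P : Q.Partition} (x xB : BitString Q.n) (τ τB : BitString Q.nz × BitString Q.nx)

theorem published_combine : published P (combine P (x, τ)) (combine P (xB, τB)) =
    (τ.1, τ.2, τB.1, τB.2, P, Q.syndrome x) := by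
  simp only [published, info_combine, testZ_combine, testX_combine]

theorem info_combine_add :
    info P (combine P (x, τ) + combine P (xB, τB)) = x + xB :=
  congrArg₂ (· + ·) (info_combine x τ) (info_combine xB τB)

theorem testZ_combine_add :
    testZ P (combine P (x, τ) + combine P (xB, τB)) = τ.1 + τB.1 :=
  congrArg₂ (· + ·) (testZ_combine x τ) (testZ_combine xB τB)

theorem testX_combine_add :
    testX P (combine P (x, τ) + combine P (xB, τB)) = τ.2 + τB.2 :=
  congrArg₂ (· + ·) (testX_combine x τ) (testX_combine xB τB)

theorem testPassed_combine_iff : TestPassed P (combine P (x, τ)) (combine P (xB, τB)) ↔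
    (hammingNorm (τ.1 + τB.1) : ℝ) / Q.nz ≤ Q.paz ∧
      (hammingNorm (τ.2 + τB.2) : ℝ) / Q.nx ≤ Q.pax := by
  rw [TestPassed, testZ_combine_add, testX_combine_add]

theorem undetected_combine_iff : Undetected P (combine P (x, τ) + combine P (xB, τB)) ↔
    (hammingNorm (τ.2 + τB.2) : ℝ) / Q.nx ≤ Q.pax ∧
      minDist Q.rows ≤ 2 * hammingNorm (x + xB) := by
  rw [Undetected, info_combine_add, testX_combine_add]

end Params

section Security

open Params

variable {Q : Params} (A : CollectiveAttack Q.N) {C : ℝ}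

theorem norm_sum_inner_probeState_bases_le
    {K : BitString Q.n → EuclideanSpace ℂ A.Probes →L[ℂ] EuclideanSpace ℂ A.Probes}
    {V : Submodule Bit (BitString Q.n)} {v : BitString Q.n}
    (hodd : ∀ x x₀, (∀ u ∈ V, x₀ ⬝ᵥ u = 0) → K (x + x₀) = bitChar (x₀ ⬝ᵥ v) • K x)
    (hK : ∀ x, ‖K x‖ ≤ C) (P : Q.Partition) (τ τB : BitString Q.nz × BitString Q.nx) :
    ‖∑ x, ∑ xB, inner ℂ (A.probeState (bases P) (combine P (x, τ)) (combine P (xB, τB)))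
        (K x (A.probeState (bases P) (combine P (x, τ)) (combine P (xB, τB))))‖ ≤
      2 * C * (√(∑ s, ∑ t, A.outcomeProb (conjugateBases P) (combine P (s, τ))
          (combine P (t, τB))) *
        √(∑ s, ∑ t with distToSubspace v V ≤ 2 * hammingNorm (s + t),
          A.outcomeProb (conjugateBases P) (combine P (s, τ)) (combine P (t, τB)))) := by
  simp only [probeState_bases_eq, map_smul, inner_smul_left, inner_smul_right, map_inv₀, map_pow,
    Complex.conj_ofNat, ← Finset.mul_sum, norm_mul, norm_inv, norm_pow, Complex.norm_ofNat,
    ← A.norm_sq_probeState]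
  rw [← mul_assoc, ← mul_inv, inv_mul_le_iff₀ (by positivity), ← mul_assoc, mul_comm _ (2 * C)]
  exact norm_sum_sum_inner_walshHadamard_walshHadamard_le hodd hK _

open Classical in
theorem norm_sum_inner_hybridDiff_combine_le
    {G : Q.Public → Q.Key → EuclideanSpace ℂ A.Probes →L[ℂ] EuclideanSpace ℂ A.Probes}
    (hG : ∀ p k, ‖G p k‖ ≤ C) (P : Q.Partition) (l : Fin Q.m)
    (τ τB : BitString Q.nz × BitString Q.nx) :
    ‖∑ x, ∑ xB with TestPassed P (combine P (x, τ)) (combine P (xB, τB)),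
        inner ℂ (A.probeState (bases P) (combine P (x, τ)) (combine P (xB, τB)))
          (hybridDiff (G (published P (combine P (x, τ)) (combine P (xB, τB)))) l
            (aliceKey P (combine P (x, τ)))
            (A.probeState (bases P) (combine P (x, τ)) (combine P (xB, τB))))‖ ≤
      4 * C * (√(∑ x, ∑ xB, A.outcomeProb (conjugateBases P) (combine P (x, τ))
          (combine P (xB, τB))) *
        √(∑ x, ∑ xB with Undetected P (combine P (x, τ) + combine P (xB, τB)),
          A.outcomeProb (conjugateBases P) (combine P (x, τ)) (combine P (xB, τB)))) := by
  have hC : 0 ≤ C := (norm_nonneg _).trans (hG (published P 0 0) 0)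
  by_cases hpass : (hammingNorm (τ.1 + τB.1) : ℝ) / Q.nz ≤ Q.paz ∧
      (hammingNorm (τ.2 + τB.2) : ℝ) / Q.nx ≤ Q.pax
  swap
  · simp only [testPassed_combine_iff, hpass, Finset.filter_false, Finset.sum_empty,
      Finset.sum_const_zero, norm_zero]
    positivity
  simp only [testPassed_combine_iff, hpass, and_self, Finset.filter_true, published_combine,
    aliceKey, info_combine, undetected_combine_iff, true_and]
  have hbound := norm_sum_inner_probeState_bases_le A
    (K := fun x => hybridDiff (G (τ.1, τ.2, τB.1, τB.2, P, Q.syndrome x)) l (Q.key x))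
    (hybridDiff_key_add Q (fun ξ => G (τ.1, τ.2, τB.1, τB.2, P, ξ)) l)
    (fun x => norm_hybridDiff_le (hG _) l (Q.key x)) P τ τB
  refine hbound.trans ?_
  rw [show 2 * (2 * C) = 4 * C by ring]
  gcongr
  · exact fun _ _ _ => A.outcomeProb_nonneg _ _ _
  · exact Q.minDist_le l

open Classical in
theorem norm_sum_inner_hybridDiff_le
    {G : Q.Public → Q.Key → EuclideanSpace ℂ A.Probes →L[ℂ] EuclideanSpace ℂ A.Probes}
    (hG : ∀ p k, ‖G p k‖ ≤ C) (P : Q.Partition) (l : Fin Q.m) :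
    ‖∑ i, ∑ iB with TestPassed P i iB, inner ℂ (A.probeState (bases P) i iB)
        (hybridDiff (G (published P i iB)) l (aliceKey P i) (A.probeState (bases P) i iB))‖ ≤
      4 * C * (√(2 ^ Q.N) *
        √(∑ i, ∑ iB with Undetected P (i + iB), A.outcomeProb (conjugateBases P) i iB)) := by
  have hC : 0 ≤ C := (norm_nonneg _).trans (hG (published P 0 0) 0)
  rw [← A.sum_sum_outcomeProb (conjugateBases P)]
  simp only [Finset.sum_filter]
  rw [sum_combine P, sum_combine P, sum_combine P]
  simp only [← Finset.sum_filter]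
  refine (norm_sum_le_of_le _ fun t _ =>
    norm_sum_inner_hybridDiff_combine_le A hG P l t.1 t.2).trans ?_
  rw [← Finset.mul_sum]
  gcongr
  exact Real.sum_sqrt_mul_sqrt_le _
    (fun _ => Finset.sum_nonneg fun _ _ => Finset.sum_nonneg fun _ _ => A.outcomeProb_nonneg _ _ _)
    fun _ => Finset.sum_nonneg fun _ _ => Finset.sum_nonneg fun _ _ => A.outcomeProb_nonneg _ _ _

theorem choiceProb_nonneg (Q : Params) : 0 ≤ choiceProb Q := by
  rw [choiceProb]
  positivity

theorem choiceProb_mul_le_one (Q : Params) :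
    choiceProb Q * (Fintype.card Q.Partition * 2 ^ Q.N) ≤ 1 := by
  rw [choiceProb, mul_mul_mul_comm, one_div, one_div, 
    inv_mul_cancel₀ (pow_ne_zero Q.N (two_ne_zero' ℝ)), mul_one]
  exact inv_mul_le_one

theorem sqrt_exp_sampling (n ν ε : ℝ) :
    √(Real.exp (-2 * n * (ε * ν) ^ 2)) = Real.exp (-ν ^ 2 * n * ε ^ 2) := by
  rw [← Real.exp_half]
  ring_nf

open Classical in
theorem choiceProb_mul_sum_sqrt_le {ε : ℝ} (hε : 0 ≤ ε) (hn : 0 < Q.n) (hnx : 0 < Q.nx)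
    (hd : Q.pax + ε ≤ (minDist Q.rows : ℝ) / Q.n / 2) :
    choiceProb Q * ∑ P, √(2 ^ Q.N) *
        √(∑ i, ∑ iB with Undetected P (i + iB), A.outcomeProb (conjugateBases P) i iB) ≤
      Real.exp (-((Q.nx : ℝ) / (Q.n + Q.nx)) ^ 2 * Q.n * ε ^ 2) := by
  have hchoice := choiceProb_nonneg Q
  let total : ℝ := Fintype.card Q.Partition * 2 ^ Q.N
  have htotal : ∑ _P : Q.Partition, (2 : ℝ) ^ Q.N = total := by simp [total]
  calc choiceProb Q * ∑ P, √(2 ^ Q.N) *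
        √(∑ i, ∑ iB with Undetected P (i + iB), A.outcomeProb (conjugateBases P) i iB)
      ≤ choiceProb Q * (√total * √(∑ P, ∑ i, ∑ iB with Undetected P (i + iB),
          A.outcomeProb (conjugateBases P) i iB)) := by
        gcongr
        rw [← htotal]
        exact Real.sum_sqrt_mul_sqrt_le _ (fun _ => by positivity) fun _ =>
          Finset.sum_nonneg fun _ _ => Finset.sum_nonneg fun _ _ => A.outcomeProb_nonneg _ _ _
    _ ≤ choiceProb Q * (√total * √(Real.exp (-2 * Q.n * (ε * (Q.nx / (Q.n + Q.nx))) ^ 2) *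
          total)) := by
        gcongr
        exact sum_undetected_outcomeProb_le hn hnx hd hε A
    _ = choiceProb Q * total * Real.exp (-((Q.nx : ℝ) / (Q.n + Q.nx)) ^ 2 * Q.n * ε ^ 2) := by
        rw [Real.sqrt_mul (Real.exp_pos _).le, mul_left_comm √total,
          Real.mul_self_sqrt (by positivity), sqrt_exp_sampling]
        ring
    _ ≤ _ := mul_le_of_le_one_left (Real.exp_pos _).le (choiceProb_mul_le_one Q)

open Classical in
open scoped Matrix.Norms.L2Operator in
theorem norm_trace_difference_mul_le {ε : ℝ} (hε : 0 ≤ ε) (hn : 0 < Q.n) (hnx : 0 < Q.nx)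
    (hd : Q.pax + ε ≤ (minDist Q.rows : ℝ) / Q.n / 2) (W : Matrix (ABE A) (ABE A) ℂ) :
    ‖((rhoABEprime A - rhoU Q ⊗ₖ rhoE A) * W).trace‖ ≤
      4 * ‖W‖ * Q.m * Real.exp (-((Q.nx : ℝ) / (Q.n + Q.nx)) ^ 2 * Q.n * ε ^ 2) := by
  have hchoice := choiceProb_nonneg Q
  rw [trace_difference_mul, norm_mul, Complex.norm_real, Real.norm_of_nonneg hchoice]
  calc _ ≤ choiceProb Q * ∑ P : Q.Partition, ∑ _l : Fin Q.m, 4 * ‖W‖ * (√(2 ^ Q.N) *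
          √(∑ i, ∑ iB with Undetected P (i + iB), A.outcomeProb (conjugateBases P) i iB)) := by
        gcongr
        exact norm_sum_le_of_le _ fun P _ => norm_sum_le_of_le _ fun l _ =>
          norm_sum_inner_hybridDiff_le A (norm_keyOperator_le W) P l
    _ = 4 * ‖W‖ * Q.m * (choiceProb Q * ∑ P, √(2 ^ Q.N) *
          √(∑ i, ∑ iB with Undetected P (i + iB), A.outcomeProb (conjugateBases P) i iB)) := by
        simp only [Finset.sum_const, Finset.card_univ, Fintype.card_fin, nsmul_eq_mul,
          ← Finset.mul_sum]
        ring
    _ ≤ _ := by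
        gcongr
        exact choiceProb_mul_sum_sqrt_le A hε hn hnx hd

end Security

end BB84InfoZ

end

open BB84InfoZ in
open scoped Matrix.Norms.L2Operator in
theorem mainTheorem5_general (Q : Params) {ε : ℝ} (hε : 0 ≤ ε) (hn : 0 < Q.n) (hnx : 0 < Q.nx)
    (hthreshold : Q.pax + ε ≤ (minDist Q.rows : ℝ) / Q.n / 2) (A : CollectiveAttack Q.N) :
    1 / 2 * traceNorm (rhoABEprime A - rhoU Q ⊗ₖ rhoE A) ≤
      2 * Q.m * Real.exp (-((Q.nx : ℝ) / (Q.n + Q.nx)) ^ 2 * Q.n * ε ^ 2) := by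
  classical
  obtain ⟨W, hW, htrace⟩ :=
    exists_norm_le_one_traceNorm_eq (isHermitian_rhoABEprime_sub_rhoU_kronecker_rhoE A)
  rw [htrace]
  calc _ ≤ 1 / 2 * (4 * ‖W‖ * Q.m *
          Real.exp (-((Q.nx : ℝ) / (Q.n + Q.nx)) ^ 2 * Q.n * ε ^ 2)) := by
        gcongr
        exact (Complex.re_le_norm _).trans (norm_trace_difference_mul_le A hε hn hnx hthreshold W)
    _ ≤ 1 / 2 * (4 * 1 * Q.m * Real.exp (-((Q.nx : ℝ) / (Q.n + Q.nx)) ^ 2 * Q.n * ε ^ 2)) := by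
        gcongr
    _ = _ := by ring

theorem mainTheorem5 (Q : BB84InfoZ.Params) (δ R ε : ℝ)
    (hδ : 0 < δ) (hR : 0 < R) (hε : 0 < ε)
    (hn : 0 < Q.n) (hnz : 0 < Q.nz) (hnx : 0 < Q.nx)
    (hpaz : 0 < Q.paz) (hpax : 0 < Q.pax)
    (hindep : LinearIndependent BB84InfoZ.Bit Q.rows)
    (hdist : δ < (BB84InfoZ.minDist Q.rows : ℝ) / Q.n)
    (hrate : (Q.m : ℝ) / Q.n ≤ R)
    (hthreshold : Q.pax + ε ≤ δ / 2)
    (A : BB84InfoZ.CollectiveAttack Q.N) :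
    1 / 2 * BB84InfoZ.traceNorm
        (BB84InfoZ.rhoABEprime A - BB84InfoZ.rhoU Q ⊗ₖ BB84InfoZ.rhoE A)
      ≤ 2 * R * Q.n *
        Real.exp (-((Q.nx : ℝ) / (Q.n + Q.nx)) ^ 2 * Q.n * ε ^ 2) := by
  have hm : (Q.m : ℝ) ≤ R * Q.n := (div_le_iff₀ (Nat.cast_pos.2 hn)).1 hrate
  refine (mainTheorem5_general Q hε.le hn hnx (by linarith) A).trans ?_
  rw [mul_assoc 2 R]
  gcongr
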